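/- For a finite simple graph $G$ and $m\ge 1$ let $\mathcal A_m=\mathbb Z[x]/(x^m)$, graded by $\deg x=1$, and let $H^{i,j}_{\mathcal A_m}(G)$ be the chromatic graph cohomology of $G$ over $\mathcal A_m$. That is, for a set $s$ of edges of $G$ let $[G:s]$ be the subgraph with all the vertices of $G$ and the edges in $s$. Put $C^i=\bigoplus_{|s|=i}C_s$, where $C_s=\mathcal A_m^{\otimes k(s)}$ (tensor product over $\mathbb Z$) has one factor for each of the $k(s)$ components of $[G:s]$, and let $C^{i,j}$ be the part of $C^i$ of total degree $j$ in $x$. Fix a linear order of the edges. The differential $d:C^{i,j}\to C^{i+1,j}$ is, on $C_s$, the sum over the edges $e\notin s$ of $(-1)^{t(s,e)}d_e$, where $t(s,e)$ is the number of edges in $s$ that precede $e$, and $d_e:C_s\to C_{s\cup\{e\}}$ multiplies the factors of the two components joined by $e$ if $e$ joins different components of $[G:s]$, and is the identity otherwise. $H^{i,j}_{\mathcal A_m}(G)$ is the cohomology of this complex; up to isomorphism it does not depend on the order. For $k>1$ let $G_k$ be the following simple plane graph with $4(k+1)$ vertices. Its vertices are $u_i,w_i$ with $i\in\mathbb Z/(2k+2)$,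 and its edges are $u_iu_{i+1}$, $w_iw_{i+1}$, $w_iu_i$, $w_iu_{i+1}$ for all $i\in\mathbb Z/(2k+2)$, together with $u_iu_{2k+1-i}$ for $1\le i\le k-1$. Thus the $u_i$ span a strip of $k$ squares with boundary cycle $u_0u_1\cdots u_{2k+1}$, and this strip is surrounded by a closed band of $4k+4$ triangles. Then for every $k>1$ (and every order of the edges) $$H^{1,8(k+1)-3}_{\mathcal A_3}(G_k)\cong \mathbb Z_{6k+6}\oplus\mathbb Z_3^{4k+2}\oplus\mathbb Z^{5k+5}.$$ In particular, arbitrarily large cyclic torsion occurs: for every $N$ there is $k>1$ such that $H^{1,8(k+1)-3}_{\mathcal A_3}(G_k)$ has a direct summand that is a finite cyclic group of order at least $N$. -/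

import Mathlib

open scoped TensorProduct

noncomputable section

namespace ChromaticCohomology

section Complex

variable {V : Type*} (G : SimpleGraph V)

/-- For a set `s` of edges of `G`, the subgraph `[G : s]` that contains all the vertices of `G` and
the edges in `s`. -/
def spanning (s : Finset G.edgeSet) : SimpleGraph V :=
  SimpleGraph.fromEdgeSet (Subtype.val '' (s : Set G.edgeSet))

/-- The set of connected components of `[G : s]`. -/
abbrev Comp (s : Finset G.edgeSet) : Type _ := (spanning G s).ConnectedComponent

variable {G} in
theorem spanning_mono {s t : Finset G.edgeSet} (h : s ⊆ t) : spanning G s ≤ spanning G t :=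
  SimpleGraph.fromEdgeSet_mono (Set.image_mono (Finset.coe_subset.2 h))

variable {G} in
/-- For `s ⊆ t`, the map that sends a component of `[G : s]` to the component of `[G : t]` that
contains it. -/
def compMap {s t : Finset G.edgeSet} (h : s ⊆ t) : Comp G s → Comp G t :=
  SimpleGraph.ConnectedComponent.map (SimpleGraph.Hom.ofLE (spanning_mono h))

variable (k : Type*) [CommRing k] (A : Type*) [CommRing A] [Algebra k A]

/-- The module `A ⊗ ⋯ ⊗ A` of the state `s`, with one tensor factor `A` (over `k`) attached to each
component of `[G : s]`. -/
abbrev StateModule (s : Finset G.edgeSet) : Type _ := ⨂[k] (_ : Comp G s), A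

variable [Finite V]

open Classical in
variable {G A} in
/-- Given an element `a c` of `A` for each component `c` of `[G : s]`, the product of those `a c`
for which `c` is contained in the component `c'` of `[G : t]`. -/
def blockProd {s t : Finset G.edgeSet} (h : s ⊆ t) (a : Comp G s → A) (c' : Comp G t) : A :=
  letI : Fintype (Comp G s) := Fintype.ofFinite _
  ∏ c with compMap h c = c', a c

open Classical in
variable {G A} in
theorem blockProd_update {s t : Finset G.edgeSet} (h : s ⊆ t) [DecidableEq (Comp G s)] (a : Comp G s → A) (c : Comp G s) :
    ∃ r : A, ∀ z : A, blockProd h (Function.update a c z) =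
      Function.update (blockProd h a) (compMap h c) (z * r) := by
  let _ : Fintype (Comp G s) := Fintype.ofFinite _
  refine ⟨∏ b ∈ (Finset.univ.filter (fun b => compMap h b = compMap h c)).erase c, a b,
    fun z => ?_⟩
  funext c'
  simp only [blockProd]
  by_cases hc : c' = compMap h c
  · subst hc
    rw [Function.update_self, ← Finset.mul_prod_erase _ _ (a := c) (by simp)]
    congr 1
    · simp
    · refine Finset.prod_congr (by ext b; simp) fun b hb => ?_
      rw [Function.update_of_ne (Finset.ne_of_mem_erase hb)]
  · rw [Function.update_of_ne hc]
    refine Finset.prod_congr rfl fun b hb => ?_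
    rw [Function.update_of_ne]
    rintro rfl
    exact hc (Finset.mem_filter.1 hb).2.symm

/-- For `s ⊆ t`, the linear map from the module of `s` to that of `t` that multiplies the factors
of components of `[G : s]` which are contained in the same component of `[G : t]`. If `t` has
one edge `e` more than `s`, then two factors are multiplied if `e` joins two components, and the
map is the identity if both ends of `e` lie in one component. -/
def merge {s t : Finset G.edgeSet} (h : s ⊆ t) :
    StateModule G k A s →ₗ[k] StateModule G k A t :=
  PiTensorProduct.lift
    { toFun := fun a => PiTensorProduct.tprod k (blockProd h a)
      map_update_add' := by
        classical
        intro _ a c x y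
        obtain ⟨r, hr⟩ := blockProd_update h a c
        rw [hr, hr, hr, add_mul, MultilinearMap.map_update_add]
      map_update_smul' := by
        classical
        intro _ a c x y
        obtain ⟨r, hr⟩ := blockProd_update h a c
        rw [hr, hr, smul_mul_assoc, MultilinearMap.map_update_smul] }

/-- The sum of the modules of all the states (finitely many). -/
abbrev Cochain : Type _ := (s : Finset G.edgeSet) → StateModule G k A s

open Classical in
/-- The differential `d`, for the order of the edges that is given by a numbering `ν`. The component
of `d f` in the module of `t` is the sum over `e ∈ t` of `(-1) ^ τ` times the image of the component
of `f` in the module of `s = t \ {e}`, where `τ` is the number of edges in `s` that precede `e`. -/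
def diff (ν : G.edgeSet ↪ ℕ) : Cochain G k A →ₗ[k] Cochain G k A :=
  LinearMap.pi fun t => ∑ e ∈ t,
    (-1 : k) ^ (((t.erase e).filter (fun a => ν a < ν e)).card) •
      ((merge G k A (Finset.erase_subset e t)).comp (LinearMap.proj (t.erase e)))

end Complex

section Grading

/-- The algebra `ℤ[x] / (x ^ m)`. -/
abbrev TruncPoly (m : ℕ) : Type := AdjoinRoot (Polynomial.X ^ m : Polynomial ℤ)

variable {V : Type*} [Finite V] (G : SimpleGraph V) (m : ℕ)

/-- The homogeneous part of degree `j` of the module of the state `s` over `ℤ[x] / (x ^ m)`: the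
span of the tensors of monomials `x ^ (w c)` with total exponent `j`. -/
def gradedPart (s : Finset G.edgeSet) (j : ℕ) :
    Submodule ℤ (StateModule G ℤ (TruncPoly m) s) :=
  Submodule.span ℤ
    {y | ∃ w : Comp G s → ℕ, ∑ᶠ c, w c = j ∧
      y = PiTensorProduct.tprod ℤ
        (fun c => AdjoinRoot.root (Polynomial.X ^ m : Polynomial ℤ) ^ w c)}

/-- The group `C^{i,j}` of cochains: they are supported on the states with `i` edges and have
degree `j`. -/
def cochains (i j : ℕ) : Submodule ℤ (Cochain G ℤ (TruncPoly m)) where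
  carrier := {f | ∀ s, f s ∈ gradedPart G m s j ∧ (s.card ≠ i → f s = 0)}
  add_mem' hf hg s := ⟨add_mem (hf s).1 (hg s).1,
    fun h => by rw [Pi.add_apply, (hf s).2 h, (hg s).2 h, add_zero]⟩
  zero_mem' _ := ⟨zero_mem _, fun _ => rfl⟩
  smul_mem' r _ hf s := ⟨Submodule.smul_mem _ r (hf s).1,
    fun h => by rw [Pi.smul_apply, (hf s).2 h, smul_zero]⟩

variable (ν : G.edgeSet ↪ ℕ)

/-- The cocycles in `C^{i,j}`. -/
def cocycles (i j : ℕ) : Submodule ℤ (Cochain G ℤ (TruncPoly m)) :=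
  cochains G m i j ⊓ LinearMap.ker (diff G ℤ (TruncPoly m) ν)

/-- The coboundaries in `C^{i,j}`, that is, the image of `C^{i-1,j}`, or `0` for `i = 0`. -/
def coboundaries : ℕ → ℕ → Submodule ℤ (Cochain G ℤ (TruncPoly m))
  | 0, _ => ⊥
  | i + 1, j => (cochains G m i j).map (diff G ℤ (TruncPoly m) ν)

/-- The chromatic graph cohomology group `H^{i,j}` of `G` over the algebra `ℤ[x] / (x ^ m)`. -/
abbrev cohomology (i j : ℕ) : Type _ :=
  cocycles G m ν i j ⧸ (coboundaries G m ν i j).submoduleOf (cocycles G m ν i j)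

end Grading

/-- The graph `G_k`. The vertices `inl i` with `i` modulo `2k + 2` form the boundary cycle of a
strip of `k` squares: the columns of the strip are the pairs `inl i`, `inl (2k + 1 - i)` for
`0 ≤ i ≤ k`, the first and the last of which are edges of the cycle. Around the strip runs a
closed band of triangles: on each edge `inl i`, `inl (i + 1)` of the boundary cycle stands a
triangle with apex `inr i`, and consecutive apexes `inr i`, `inr (i + 1)` are joined by an edge,
which closes a triangle with `inl (i + 1)`. -/
def stripGraph (k : ℕ) : SimpleGraph (ZMod (2 * k + 2) ⊕ ZMod (2 * k + 2)) :=
  SimpleGraph.fromRel fun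
    | .inl i, .inl j => j = i + 1 ∨ i + j + 1 = 0
    | .inl i, .inr j => i = j ∨ i = j + 1
    | .inr i, .inr j => j = i + 1
    | .inr _, .inl _ => False

end ChromaticCohomology

end

/-! Let `n` be the number of vertices, so that the degree is `2n - 3`. Two edges of a simple graph
leave at most `n - 2` components, so a state with two edges has nothing in this degree: all
1-cochains are cocycles and `H^1` is the cokernel of `C^0 → C^1`. In a state `{e}`, with `n - 1`
components, one exponent is 1 and the others are 2, so `C^1` is generated by pairs of an edge and a
component. In `C^0` the deficit 3 splits as `2 + 1` or `1 + 1 + 1`, and the differentials of these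
monomials are two kinds of relations. Hence a homomorphism from `H^1` to `M` is an `EdgeSystem` in
`M`, and it suffices to find a group that represents these systems (`nonempty_cohomology_equiv`).

The value at the component of the edge itself is minus a row sum. Eliminating it leaves a family `F
x y z` subject to local relations (`PreSystem`) and to the symmetry of the row sums `∑ y, F x y z`
in `x` and `z`.

With `u_i` at position `2i` and `w_i` at `2i + 1`, the graph is the square of a cycle of length `4k
+ 4` with chords between even vertices. A solution of the local relations amounts to arbitrary
values `C j`, `B j`, `D j` on the paths `(j, j+1, j+2)`, `(j, j+2, j+1)`, `(j, j+1, j+3)` and `α i`,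
`β i` for the two diagonals of each square (`preSystem_family`, `PreSystem.eq_family`). Symmetry at
the interior chords makes `γ = α i + β i` independent of `i`, so that the strip contributes only `γ`
times its boundary (`sum_squareDart`). Symmetry at `j, j+2` determines `B`. For `Z = C - D`,
symmetry at `j, j+1` then says that `3 (Z j - Z (j-1))` is `γ` for odd `j` and `-2γ` for even `j`
(`system_family_iff_slope`).

Put `σ = Z 1 - Z 0`. Then `γ = 3σ`, and summing round the cycle gives `(2k+2) γ = 0`, that is
`(6k+6) σ = 0`: this is the large cyclic summand. Each of the other `4k + 2` levels `Z n` is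
prescribed up to an element killed by 3. The values `Z 0`, `D j` and `α i` are free, and there are
`1 + (4k+4) + k = 5k + 5` of them. -/

open scoped TensorProduct

noncomputable section

namespace ChromaticCohomology

/-! ### Components of states with few edges; tensors of monomials -/

section States

open Classical

variable {V : Type} {G : SimpleGraph V}

/-- The component of `[G : s]` that contains the vertex `v`. -/
abbrev compOf (s : Finset G.edgeSet) (v : V) : Comp G s := (spanning G s).connectedComponentMk v

theorem compOf_surjective (s : Finset G.edgeSet) : Function.Surjective (compOf s) :=
  fun c => c.ind fun v => ⟨v, rfl⟩

theorem spanning_adj {s : Finset G.edgeSet} {x y : V} :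
    (spanning G s).Adj x y ↔ ∃ h : G.Adj x y, (⟨s(x, y), h⟩ : G.edgeSet) ∈ s := by
  simp only [spanning, SimpleGraph.fromEdgeSet_adj, Set.mem_image, Finset.mem_coe]
  constructor
  · rintro ⟨⟨⟨e, he⟩, hs, rfl⟩, -⟩
    exact ⟨he, hs⟩
  · rintro ⟨h, hs⟩
    exact ⟨⟨_, hs, rfl⟩, h.ne⟩

theorem compOf_eq_of_mem {s : Finset G.edgeSet} {x y : V} (h : G.Adj x y)
    (hs : (⟨s(x, y), h⟩ : G.edgeSet) ∈ s) : compOf s x = compOf s y :=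
  SimpleGraph.ConnectedComponent.eq.2 (spanning_adj.2 ⟨h, hs⟩).reachable

theorem compOf_empty_injective : Function.Injective (compOf (∅ : Finset G.edgeSet)) := by
  intro x y h
  obtain ⟨p⟩ := SimpleGraph.ConnectedComponent.eq.1 h
  cases p with
  | nil => rfl
  | cons h _ => simp [spanning_adj] at h

theorem compOf_singleton_eq_iff {p q : V} (h : G.Adj p q) {x y : V} :
    compOf {⟨s(p, q), h⟩} x = compOf {(⟨s(p, q), h⟩ : G.edgeSet)} y ↔
      x = y ∨ ((x = p ∨ x = q) ∧ (y = p ∨ y = q)) := by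
  constructor
  · intro hxy
    -- Collapsing `q` to `p` gives a function that is constant along walks in the state `{pq}`.
    have key : ∀ u v : V, (spanning G {(⟨s(p, q), h⟩ : G.edgeSet)}).Reachable u v →
        (if u = q then p else u) = if v = q then p else v := by
      rintro u v ⟨w⟩
      induction w with
      | nil => rfl
      | @cons u v w hadj _ ih =>
        rw [← ih]
        obtain ⟨_, h2⟩ := spanning_adj.1 hadj
        rcases Sym2.eq_iff.1 (congrArg Subtype.val (Finset.mem_singleton.1 h2)) with ⟨rfl, rfl⟩ | ⟨rfl, rfl⟩ <;> simp
    have := key _ _ (SimpleGraph.ConnectedComponent.eq.1 hxy)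
    split_ifs at this with h1 h2 h2 <;> simp_all
  · have hpq := compOf_eq_of_mem h (Finset.mem_singleton_self _)
    rintro (rfl | ⟨rfl | rfl, rfl | rfl⟩) <;> simp [hpq]

variable [Fintype V]

instance (s : Finset G.edgeSet) : Fintype (Comp G s) := Fintype.ofFinite _

/-- Distinct edges `e`, `f` of a simple graph have ends `a` of `e` off `f` and `c` of `f` off `e`.
Each of these is joined to its partner, which is neither `a` nor `c`, so the vertices other than `a`
and `c` meet every component. -/
theorem card_comp_add_two_le {t : Finset G.edgeSet} (ht : t.card = 2) :
    Fintype.card (Comp G t) + 2 ≤ Fintype.card V := by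
  obtain ⟨⟨e, he⟩, ⟨f, hf⟩, hef, rfl⟩ := Finset.card_eq_two.1 ht
  have hef' : e ≠ f := fun h => hef (Subtype.ext h)
  obtain ⟨a, hae, haf⟩ : ∃ a ∈ e, a ∉ f := by
    induction e with | _ x y
    by_contra! hc
    exact hef' (((Sym2.mem_and_mem_iff (SimpleGraph.Adj.ne he)).1
      ⟨hc x (by simp), hc y (by simp)⟩).symm)
  obtain ⟨c, hcf, hce⟩ : ∃ c ∈ f, c ∉ e := by
    induction f with | _ x y
    by_contra! hc
    exact hef' (((Sym2.mem_and_mem_iff (SimpleGraph.Adj.ne hf)).1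
      ⟨hc x (by simp), hc y (by simp)⟩))
  obtain ⟨b, rfl⟩ := hae
  obtain ⟨d, rfl⟩ := hcf
  set t : Finset G.edgeSet := {⟨s(a, b), he⟩, ⟨s(c, d), hf⟩}
  have hac : a ≠ c := fun h => hce (by simp [h])
  have hba : b ≠ a := (SimpleGraph.Adj.ne he).symm
  have hdc : d ≠ c := (SimpleGraph.Adj.ne hf).symm
  have hbc : b ≠ c := fun h => hce (by simp [h])
  have hda : d ≠ a := fun h => haf (by simp [h])
  have hs : Function.Surjective
      (fun v : ({a, c}ᶜ : Finset V) => compOf t v.1) := by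
    intro z
    obtain ⟨v, rfl⟩ := compOf_surjective t z
    by_cases hva : v = a
    · refine ⟨⟨b, by simp [hba, hbc]⟩, ?_⟩
      rw [hva]
      exact (compOf_eq_of_mem he (by simp [t])).symm
    by_cases hvc : v = c
    · refine ⟨⟨d, by simp [hdc, hda]⟩, ?_⟩
      rw [hvc]
      exact (compOf_eq_of_mem hf (by simp [t])).symm
    exact ⟨⟨v, by simp [hva, hvc]⟩, rfl⟩
  have h1 := Fintype.card_le_of_surjective _ hs
  rw [Fintype.card_coe, Finset.card_compl, Finset.card_pair hac] at h1
  have h2 : 2 ≤ Fintype.card V := by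
    rw [← Finset.card_pair hac]; exact Finset.card_le_univ _
  omega

/-- The generator `x` of `ℤ[x] / (x ^ 3)`. -/
abbrev gen : TruncPoly 3 := AdjoinRoot.root (Polynomial.X ^ 3 : Polynomial ℤ)

theorem gen_pow_eq_zero {n : ℕ} (h : 3 ≤ n) : gen ^ n = 0 := by
  have : gen ^ 3 = 0 := by
    rw [gen, ← AdjoinRoot.mk_X, ← map_pow, AdjoinRoot.mk_self]
  exact pow_eq_zero_of_le h this

/-- The coefficient of `x ^ i` in an element of `ℤ[x] / (x ^ 3)`. -/
def coef (i : ℕ) : TruncPoly 3 →ₗ[ℤ] ℤ :=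
  Polynomial.lcoeff ℤ i ∘ₗ AdjoinRoot.modByMonicHom (Polynomial.monic_X_pow 3)

theorem coef_gen_pow {i : ℕ} (hi : i < 3) (n : ℕ) :
    coef i (gen ^ n) = if n = i then 1 else 0 := by
  by_cases hn : 3 ≤ n
  · rw [gen_pow_eq_zero hn, map_zero, if_neg (by omega)]
  · have hn' : n < 3 := by omega
    rw [coef, LinearMap.comp_apply, gen, ← AdjoinRoot.mk_X, ← map_pow,
      AdjoinRoot.modByMonicHom_mk, (Polynomial.modByMonic_eq_self_iff
        (Polynomial.monic_X_pow 3)).2 (by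
          rw [Polynomial.degree_X_pow, Polynomial.degree_X_pow]; exact_mod_cast hn'),
      Polynomial.lcoeff_apply, Polynomial.coeff_X_pow]
    simp [eq_comm]

/-- The tensor of monomials with exponents `w` in the module of the state `s`. -/
def mono (s : Finset G.edgeSet) (w : Comp G s → ℕ) : StateModule G ℤ (TruncPoly 3) s :=
  PiTensorProduct.tprod ℤ fun c => gen ^ w c

omit [Fintype V] in
theorem mono_eq_zero {s : Finset G.edgeSet} {w : Comp G s → ℕ} (c : Comp G s) (hc : 3 ≤ w c) :
    mono s w = 0 :=
  MultilinearMap.map_coord_zero _ c (gen_pow_eq_zero hc)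

theorem merge_mono {s t : Finset G.edgeSet} (h : s ⊆ t) (w : Comp G s → ℕ) :
    merge G ℤ (TruncPoly 3) h (mono s w) =
      mono t fun c' => ∑ c with compMap h c = c', w c := by
  simp only [merge, mono, PiTensorProduct.lift.tprod]
  change PiTensorProduct.tprod ℤ (blockProd h fun c => gen ^ w c) = _
  congr 1
  funext c'
  simp only [blockProd, Finset.prod_pow_eq_pow_sum]

theorem gradedPart_eq_span (s : Finset G.edgeSet) (j : ℕ) :
    gradedPart G 3 s j = Submodule.span ℤ {y | ∃ w : Comp G s → ℕ, ∑ c, w c = j ∧ y = mono s w} := by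
  simp only [gradedPart, finsum_eq_sum_of_fintype]
  rfl

theorem mono_mem {s : Finset G.edgeSet} {w : Comp G s → ℕ} {j : ℕ} (h : ∑ c, w c = j) :
    mono s w ∈ gradedPart G 3 s j := by
  rw [gradedPart_eq_span]
  exact Submodule.subset_span ⟨w, h, rfl⟩

/-- Pigeonhole: if the degree exceeds twice the number of components, some factor is `x ^ r` with `r
≥ 3`. -/
theorem merge_eq_zero {s t : Finset G.edgeSet} (h : s ⊆ t) {j : ℕ}
    (hj : 2 * Fintype.card (Comp G t) < j) {y : StateModule G ℤ (TruncPoly 3) s}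
    (hy : y ∈ gradedPart G 3 s j) : merge G ℤ (TruncPoly 3) h y = 0 := by
  rw [gradedPart_eq_span] at hy
  induction hy using Submodule.span_induction with
  | mem y hy =>
    obtain ⟨w, hw, rfl⟩ := hy
    rw [merge_mono]
    obtain ⟨c, hc⟩ : ∃ c' : Comp G t, 3 ≤ ∑ c with compMap h c = c', w c := by
      by_contra! hc
      have h1 : ∑ c' : Comp G t, ∑ c with compMap h c = c', w c ≤ ∑ c' : Comp G t, 2 :=
        Finset.sum_le_sum fun c' _ => Nat.lt_succ_iff.1 (hc c')
      rw [Finset.sum_fiberwise Finset.univ (compMap h) w, hw, Finset.sum_const, Finset.card_univ,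
        smul_eq_mul] at h1
      omega
    exact mono_eq_zero c hc
  | zero => exact map_zero _
  | add x y _ _ hx hy => rw [map_add, hx, hy, add_zero]
  | smul r x _ hx => rw [map_smul, hx, smul_zero]

/-- The tensor of monomials in the module of the state `∅`, with exponents given on vertices. -/
def vmono (G : SimpleGraph V) (W : V → ℕ) : StateModule G ℤ (TruncPoly 3) ∅ :=
  mono ∅ fun c => W (Function.surjInv (compOf_surjective _) c)

omit [Fintype V] in
theorem surjInv_compOf (v : V) :
    Function.surjInv (compOf_surjective (∅ : Finset G.edgeSet)) (compOf ∅ v) = v :=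
  Function.leftInverse_surjInv ⟨compOf_empty_injective, compOf_surjective _⟩ v

theorem sum_comp_empty {M : Type*} [AddCommMonoid M] (f : Comp G ∅ → M) :
    ∑ c, f c = ∑ v, f (compOf ∅ v) :=
  (Fintype.sum_bijective (compOf ∅) ⟨compOf_empty_injective, compOf_surjective _⟩ _ _
    fun _ => rfl).symm

omit [Fintype V] in
theorem mono_empty (w : Comp G ∅ → ℕ) : mono ∅ w = vmono G fun v => w (compOf ∅ v) := by
  rw [vmono]
  congr 1
  funext c
  rw [Function.surjInv_eq (compOf_surjective _) c]

theorem vmono_mem {W : V → ℕ} {j : ℕ} (h : ∑ v, W v = j) : vmono G W ∈ gradedPart G 3 ∅ j := by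
  refine mono_mem ?_
  rw [sum_comp_empty]
  simpa only [surjInv_compOf] using h

theorem merge_vmono (t : Finset G.edgeSet) (W : V → ℕ) :
    merge G ℤ (TruncPoly 3) (Finset.empty_subset t) (vmono G W) =
      mono t fun c => ∑ v with compOf t v = c, W v := by
  rw [vmono, merge_mono]
  congr 1
  funext c
  rw [Finset.sum_filter, sum_comp_empty, Finset.sum_filter]
  simp only [surjInv_compOf]
  rfl

theorem sum_block {p q : V} (h : G.Adj p q) (W : V → ℕ) (x : V) :
    ∑ v with compOf {(⟨s(p, q), h⟩ : G.edgeSet)} v = compOf {⟨s(p, q), h⟩} x, W v =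
      if x = p ∨ x = q then W p + W q else W x := by
  split_ifs with hx
  · rw [← Finset.sum_pair h.ne]
    congr 1
    ext v
    simp only [Finset.mem_filter, Finset.mem_univ, true_and, compOf_singleton_eq_iff,
      Finset.mem_insert, Finset.mem_singleton]
    grind
  · rw [← Finset.sum_singleton W x]
    congr 1
    ext v
    simp only [Finset.mem_filter, Finset.mem_univ, true_and, compOf_singleton_eq_iff,
      Finset.mem_singleton]
    grind

/-- The tensor of monomials in the module of the state `{e}` with exponent `1` at the component of
the vertex `z` and `2` at the other components. -/
def edgeMono (e : G.edgeSet) (z : V) : StateModule G ℤ (TruncPoly 3) {e} :=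
  mono {e} fun c => if c = compOf {e} z then 1 else 2

theorem merge_vmono_eq_zero {p q : V} (h : G.Adj p q) {W : V → ℕ} (hW : 3 ≤ W p + W q) :
    merge G ℤ (TruncPoly 3) (Finset.empty_subset {⟨s(p, q), h⟩}) (vmono G W) = 0 := by
  rw [merge_vmono]
  refine mono_eq_zero (compOf _ p) ?_
  rw [sum_block, if_pos (Or.inl rfl)]
  exact hW

/-- The vertex `z` may be an end of the edge; then the merged factor is the one with exponent 1. -/
theorem merge_vmono_eq_edgeMono {p q : V} (h : G.Adj p q) {W : V → ℕ} (z : V)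
    (h1 : W p + W q = if z = p ∨ z = q then 1 else 2)
    (h2 : ∀ x, x ≠ p → x ≠ q → W x = if x = z then 1 else 2) :
    merge G ℤ (TruncPoly 3) (Finset.empty_subset {⟨s(p, q), h⟩}) (vmono G W) =
      edgeMono ⟨s(p, q), h⟩ z := by
  rw [merge_vmono, edgeMono]
  congr 1
  funext c
  obtain ⟨x, rfl⟩ := compOf_surjective _ c
  rw [sum_block]
  simp only [compOf_singleton_eq_iff]
  by_cases hx : x = p ∨ x = q
  · rw [if_pos hx, h1]
    congr 1
    simp only [hx, true_and, eq_iff_iff]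
    grind
  · rw [if_neg hx]
    rw [not_or] at hx
    rw [h2 x hx.1 hx.2]
    simp [hx.1, hx.2]

end States

/-! ### Presentation of the first cohomology in degree `2|V| - 3` -/

section FirstCohomology

open Classical

variable {V : Type} [Fintype V] {G : SimpleGraph V} (ν : G.edgeSet ↪ ℕ)

theorem diff_apply_eq_zero {f : Cochain G ℤ (TruncPoly 3)} {t : Finset G.edgeSet}
    (h : ∀ (s : Finset G.edgeSet) (hs : s ⊆ t), s.card + 1 = t.card →
      merge G ℤ (TruncPoly 3) hs (f s) = 0) :
    diff G ℤ (TruncPoly 3) ν f t = 0 := by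
  simp only [diff, LinearMap.pi_apply, LinearMap.sum_apply]
  refine Finset.sum_eq_zero fun e he => ?_
  rw [LinearMap.smul_apply, LinearMap.comp_apply, LinearMap.proj_apply,
    h _ _ (Finset.card_erase_add_one he), smul_zero]

/-- No edge precedes `e` in the empty state, so the sign is 1. This is why the order of the edges
plays no role in the presentation. -/
theorem diff_apply_singleton (f : Cochain G ℤ (TruncPoly 3)) (e : G.edgeSet) :
    diff G ℤ (TruncPoly 3) ν f {e} =
      merge G ℤ (TruncPoly 3) (Finset.empty_subset {e}) (f ∅) := by
  -- The erased set is only propositionally empty and occurs in the type of `merge`, so it is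
  -- replaced by a variable.
  have key : ∀ s : Finset G.edgeSet, s = ∅ → ∀ hs : s ⊆ {e}, merge G ℤ (TruncPoly 3) hs (f s) =
      merge G ℤ (TruncPoly 3) (Finset.empty_subset {e}) (f ∅) := by
    rintro s rfl hs; rfl
  have he : ({e} : Finset G.edgeSet).erase e = ∅ := by ext a; simp
  simp only [diff, LinearMap.pi_apply, Finset.sum_singleton,
    LinearMap.smul_apply, LinearMap.comp_apply, LinearMap.proj_apply]
  rw [key _ he, he]
  simp

/-- The cochain with value `y` at the state `{e}` and `0` at the other states. -/
def edgeSingle (e : G.edgeSet) (y : StateModule G ℤ (TruncPoly 3) {e}) :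
    Cochain G ℤ (TruncPoly 3) :=
  Pi.single {e} y

omit [Fintype V] in
theorem edgeSingle_same (e : G.edgeSet) (y : StateModule G ℤ (TruncPoly 3) {e}) :
    edgeSingle e y {e} = y := Pi.single_eq_same _ _

omit [Fintype V] in
theorem edgeSingle_of_ne {e : G.edgeSet} {s : Finset G.edgeSet} (h : s ≠ {e})
    (y : StateModule G ℤ (TruncPoly 3) {e}) : edgeSingle e y s = 0 := Pi.single_eq_of_ne h _

omit [Fintype V] in
theorem edgeSingle_zero (e : G.edgeSet) :
    edgeSingle e (0 : StateModule G ℤ (TruncPoly 3) {e}) = 0 := Pi.single_zero _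

omit [Fintype V] in
theorem edgeSingle_add (e : G.edgeSet) (x y : StateModule G ℤ (TruncPoly 3) {e}) :
    edgeSingle e (x + y) = edgeSingle e x + edgeSingle e y := Pi.single_add _ _ _

omit [Fintype V] in
theorem edgeSingle_smul (e : G.edgeSet) (r : ℤ) (y : StateModule G ℤ (TruncPoly 3) {e}) :
    edgeSingle e (r • y) = r • edgeSingle e y := Pi.single_smul _ _ _

/-- The part on the edge `e` of the differential of a tensor of monomials on the vertices. -/
def edgePart (W : V → ℕ) (e : Sym2 V) : Cochain G ℤ (TruncPoly 3) :=
  if h : e ∈ G.edgeSet then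
    edgeSingle ⟨e, h⟩ (merge G ℤ (TruncPoly 3) (Finset.empty_subset _) (vmono G W)) else 0

/-- The cochain supported on the state `{e}` with exponent `1` at the component of the vertex `z`
and `2` at the other components. -/
def edgeCochain (G : SimpleGraph V) (e : Sym2 V) (z : V) : Cochain G ℤ (TruncPoly 3) :=
  if h : e ∈ G.edgeSet then edgeSingle ⟨e, h⟩ (edgeMono ⟨e, h⟩ z) else 0

theorem diff_vmono (W : V → ℕ) :
    diff G ℤ (TruncPoly 3) ν (Pi.single ∅ (vmono G W)) = ∑ e : Sym2 V, edgePart W e := by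
  funext t
  rw [Finset.sum_apply]
  by_cases ht : ∃ e, t = {e}
  · obtain ⟨e, rfl⟩ := ht
    rw [diff_apply_singleton, Pi.single_eq_same, Finset.sum_eq_single e.1]
    · rw [edgePart, dif_pos e.2, edgeSingle_same]
    · rintro e' - he'
      rw [edgePart]
      split_ifs with h
      · rw [edgeSingle_of_ne]
        simp only [ne_eq, Finset.singleton_inj]
        exact fun h => he' (congrArg Subtype.val h).symm
      · rfl
    · simp
  · rw [diff_apply_eq_zero, Finset.sum_eq_zero]
    · rintro e -
      rw [edgePart]
      split_ifs with h
      · rw [edgeSingle_of_ne]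
        exact fun h => ht ⟨_, h⟩
      · rfl
    · intro s hs hc
      rw [Pi.single_eq_of_ne, map_zero]
      rintro rfl
      exact ht (Finset.card_eq_one.1 hc.symm)

theorem sum_sym2_mem {M : Type*} [AddCommMonoid M] (a : V) (f : Sym2 V → M)
    (hf : ∀ e, a ∉ e → f e = 0) : ∑ e, f e = ∑ c, f s(a, c) := by
  refine (Finset.sum_of_injOn (fun c => s(a, c)) (fun x _ y _ h => Sym2.congr_right.1 h)
    (fun _ _ => by simp) (fun e _ he => hf e fun h => he ?_) fun _ _ => rfl).symm
  obtain ⟨c, rfl⟩ := h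
  exact ⟨c, by simp, rfl⟩

theorem edgePart_eq_zero {W : V → ℕ} {p q : V} (h : 3 ≤ W p + W q) :
    edgePart (G := G) W s(p, q) = 0 := by
  rw [edgePart]
  split_ifs with hpq
  · rw [merge_vmono_eq_zero hpq h, edgeSingle_zero]
  · rfl

theorem edgePart_eq_edgeCochain {p q : V} {W : V → ℕ} (z : V)
    (h1 : W p + W q = if z = p ∨ z = q then 1 else 2)
    (h2 : ∀ x, x ≠ p → x ≠ q → W x = if x = z then 1 else 2) :
    edgePart (G := G) W s(p, q) = edgeCochain G s(p, q) z := by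
  rw [edgePart, edgeCochain]
  split_ifs with hpq
  · rw [merge_vmono_eq_edgeMono hpq z h1 h2]
  · rfl

omit [Fintype V] in
theorem edgeCochain_of_notMem {e : Sym2 V} (he : e ∉ G.edgeSet) (z : V) :
    edgeCochain G e z = 0 := dif_neg he

theorem edgePart_of_notMem {e : Sym2 V} (he : e ∉ G.edgeSet) (W : V → ℕ) :
    edgePart (G := G) W e = 0 := dif_neg he

/-- Away from `a` the exponents are 2 with the one exception `b`, so an edge that misses `a` merges
to exponent at least 3. On the edge `a c` the exponent 0 of `a` is absorbed by that of `c`, and the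
exponent 1 stays with the component of `b`, even if `c = b`. -/
theorem diff_vmono_pair {a b : V} (hab : a ≠ b) :
    diff G ℤ (TruncPoly 3) ν
      (Pi.single ∅ (vmono G fun v => if v = a then 0 else if v = b then 1 else 2)) =
      ∑ c, edgeCochain G s(a, c) b := by
  rw [diff_vmono, sum_sym2_mem a]
  · refine Finset.sum_congr rfl fun c _ => ?_
    by_cases hac : a = c
    · subst hac
      rw [edgeCochain_of_notMem (by simp), edgePart_of_notMem (by simp)]
    · refine edgePart_eq_edgeCochain b ?_ ?_
      · grind
      · grind
  · intro e he
    induction e with | _ p q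
    by_cases hpq : p = q
    · subst hpq
      rw [edgePart_of_notMem (by simp)]
    · simp only [Sym2.mem_iff, not_or] at he
      apply edgePart_eq_zero
      grind

/-- An edge survives only if both of its ends have exponent 1, which leaves the three pairs among
`a`, `b`, `c`. -/
theorem diff_vmono_triple {a b c : V} (hab : a ≠ b) (hbc : b ≠ c) (hac : a ≠ c) :
    diff G ℤ (TruncPoly 3) ν
      (Pi.single ∅ (vmono G fun v => if v = a ∨ v = b ∨ v = c then 1 else 2)) =
      edgeCochain G s(a, b) c + edgeCochain G s(b, c) a + edgeCochain G s(a, c) b := by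
  rw [diff_vmono]
  have hsub : ∑ e ∈ ({s(a, b), s(b, c), s(a, c)} : Finset (Sym2 V)),
      edgePart (fun v => if v = a ∨ v = b ∨ v = c then 1 else 2) e =
      ∑ e, edgePart (G := G) (fun v => if v = a ∨ v = b ∨ v = c then 1 else 2) e := by
    refine Finset.sum_subset (Finset.subset_univ _) fun e _ he => ?_
    induction e with | _ p q
    by_cases hpq : p = q
    · subst hpq
      rw [edgePart_of_notMem (by simp)]
    · simp only [Finset.mem_insert, Finset.mem_singleton, Sym2.eq_iff, not_or] at he
      apply edgePart_eq_zero
      grind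
  have h1 : s(b, c) ≠ s(a, c) := by
    simp only [ne_eq, Sym2.eq_iff]; grind
  have h2 : s(a, b) ≠ s(b, c) := by
    simp only [ne_eq, Sym2.eq_iff]; grind
  have h3 : s(a, b) ≠ s(a, c) := by
    simp only [ne_eq, Sym2.eq_iff]; grind
  rw [← hsub, Finset.sum_insert (by simp only [Finset.mem_insert, Finset.mem_singleton]; tauto),
    Finset.sum_insert (by simpa only [Finset.mem_singleton] using h1), Finset.sum_singleton,
    ← add_assoc]
  clear hsub h1 h2 h3
  congr 1
  · congr 1
    · apply edgePart_eq_edgeCochain <;> grind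
    · apply edgePart_eq_edgeCochain <;> grind
  · apply edgePart_eq_edgeCochain <;> grind

/-- The relations of the first cohomology in the degree in question, for a family `F e z` that
corresponds to the cochains `edgeCochain G e z`. -/
structure EdgeSystem (G : SimpleGraph V) {M : Type*} [AddCommGroup M] (F : Sym2 V → V → M) :
    Prop where
  supp : ∀ e z, e ∉ G.edgeSet → F e z = 0
  ends : ∀ x y, F s(x, y) x = F s(x, y) y
  pair : ∀ a b, a ≠ b → ∑ c, F s(a, c) b = 0
  triple : ∀ a b c, a ≠ b → b ≠ c → a ≠ c → F s(a, b) c + F s(b, c) a + F s(a, c) b = 0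

theorem exists_eq_one_of_sum_eq_one {ι : Type*} {s : Finset ι} {f : ι → ℕ}
    (h : ∑ i ∈ s, f i = 1) : ∃ i ∈ s, f i = 1 ∧ ∀ j ∈ s, j ≠ i → f j = 0 := by
  obtain ⟨i, hi, hi0⟩ := Finset.exists_ne_zero_of_sum_ne_zero (h.trans_ne one_ne_zero)
  rw [← Finset.add_sum_erase _ _ hi] at h
  have h0 : ∑ j ∈ s.erase i, f j = 0 := by omega
  exact ⟨i, hi, by omega, fun j hj hji =>
    Finset.sum_eq_zero_iff.1 h0 j (Finset.mem_erase.2 ⟨hji, hj⟩)⟩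

/-! ### Evaluation of cochains in a solution of the relations -/

section Evaluation

variable {M : Type*} [AddCommGroup M] (F : Sym2 V → V → M)

/-- The linear map that sends `edgeMono e z` to `F e z`. -/
def evalEdge (e : G.edgeSet) : StateModule G ℤ (TruncPoly 3) {e} →ₗ[ℤ] M :=
  -- The product of coefficients detects the monomial with exponent 1 exactly at `c`. The choice of
  -- a representative vertex of `c` does not matter, by `EdgeSystem.ends`.
  PiTensorProduct.lift (∑ c : Comp G {e},
    ((MultilinearMap.mkPiAlgebra ℤ (Comp G {e}) ℤ).compLinearMap
      fun c' => coef (if c' = c then 1 else 2)).smulRight (F e.1 (Quot.out c)))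

/-- The linear map that sends `edgeCochain G e z` to `F e z`. -/
def evalMap (G : SimpleGraph V) : Cochain G ℤ (TruncPoly 3) →ₗ[ℤ] M :=
  ∑ e : G.edgeSet, (evalEdge F e).comp (LinearMap.proj (R := ℤ)
    (φ := fun s : Finset G.edgeSet => StateModule G ℤ (TruncPoly 3) s) {e})

variable {F}

theorem evalEdge_edgeMono (hF : EdgeSystem G F) (e : G.edgeSet) (z : V) :
    evalEdge F e (edgeMono e z) = F e.1 z := by
  rw [evalEdge, edgeMono, mono,
    PiTensorProduct.lift.tprod, sum_apply,
    Finset.sum_eq_single (compOf {e} z)]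
  · rw [MultilinearMap.smulRight_apply, MultilinearMap.compLinearMap_apply,
      MultilinearMap.mkPiAlgebra_apply, Finset.prod_eq_one, one_smul]
    · have h := Quot.out_eq (compOf {e} z)
      generalize Quot.out (compOf {e} z) = x at h
      change compOf {e} x = compOf {e} z at h
      obtain ⟨e, he⟩ := e
      induction e with | _ p q
      rcases (compOf_singleton_eq_iff he).1 h with rfl | ⟨rfl | rfl, rfl | rfl⟩
      · rfl
      · rfl
      · exact hF.ends _ _
      · exact (hF.ends _ _).symm
      · rfl
    · intro c _
      rw [coef_gen_pow (by split_ifs <;> omega), if_pos rfl]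
  · intro c _ hc
    rw [MultilinearMap.smulRight_apply, MultilinearMap.compLinearMap_apply,
      MultilinearMap.mkPiAlgebra_apply, Finset.prod_eq_zero (Finset.mem_univ c), zero_smul]
    rw [coef_gen_pow (by split_ifs <;> omega), if_neg (by simp [hc])]
  · simp

theorem evalMap_edgeSingle (e : G.edgeSet) (y : StateModule G ℤ (TruncPoly 3) {e}) :
    evalMap F G (edgeSingle e y) = evalEdge F e y := by
  rw [evalMap, LinearMap.sum_apply, Finset.sum_eq_single e]
  · rw [LinearMap.comp_apply, LinearMap.proj_apply, edgeSingle_same]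
  · intro e' _ he'
    rw [LinearMap.comp_apply, LinearMap.proj_apply, edgeSingle_of_ne, map_zero]
    simpa using he'
  · simp

theorem evalMap_edgeCochain (hF : EdgeSystem G F) (e : Sym2 V) (z : V) :
    evalMap F G (edgeCochain G e z) = F e z := by
  rw [edgeCochain]
  split_ifs with he
  · rw [evalMap_edgeSingle, evalEdge_edgeMono hF]
  · rw [map_zero, hF.supp e z he]

/-- The deficits `2 - W v` are at most 2 and add up to 3, and `3 = 2 + 1 = 1 + 1 + 1`. -/
theorem exists_of_sum_add_three {W : V → ℕ} (h2 : ∀ v, W v ≤ 2)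
    (h : ∑ v, W v + 3 = 2 * Fintype.card V) :
    (∃ a b, a ≠ b ∧ W = fun v => if v = a then 0 else if v = b then 1 else 2) ∨
    ∃ a b c, a ≠ b ∧ b ≠ c ∧ a ≠ c ∧ W = fun v => if v = a ∨ v = b ∨ v = c then 1 else 2 := by
  have hd : ∑ v, (2 - W v) = 3 := by
    have : ∑ v, (2 - W v) + ∑ v, W v = 2 * Fintype.card V := by
      rw [← Finset.sum_add_distrib, Finset.sum_congr rfl
        fun v _ => Nat.sub_add_cancel (h2 v)]
      simp [mul_comm]
    omega
  by_cases h0 : ∃ a, W a = 0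
  · left
    obtain ⟨a, ha⟩ := h0
    rw [← Finset.add_sum_erase _ _ (Finset.mem_univ a), ha] at hd
    have h1 : ∑ v ∈ Finset.univ.erase a, (2 - W v) = 1 := by omega
    obtain ⟨b, hb, hb1, hb2⟩ := exists_eq_one_of_sum_eq_one h1
    refine ⟨a, b, (Finset.ne_of_mem_erase hb).symm, funext fun v => ?_⟩
    have := hb2 v
    have := h2 v
    have := h2 b
    simp only [Finset.mem_erase, Finset.mem_univ, and_true] at *
    grind
  · right
    push Not at h0
    have hW : ∀ v, 2 - W v = if W v = 1 then 1 else 0 := fun v => by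
      have := h0 v; have := h2 v; split_ifs <;> omega
    rw [Finset.sum_congr rfl fun v _ => hW v, ← Finset.card_filter, Finset.card_eq_three] at hd
    obtain ⟨a, b, c, hab, hac, hbc, hs⟩ := hd
    refine ⟨a, b, c, hab, hbc, hac, funext fun v => ?_⟩
    have hv : W v = 1 ↔ v = a ∨ v = b ∨ v = c := by
      have := congrArg (v ∈ ·) hs
      simpa using this
    have := h0 v
    have := h2 v
    split_ifs with h <;> grind

/-- The degree-`j` part of `C^0` is spanned by the two kinds of monomials, and their differentials
evaluate to the relations `pair` and `triple`. -/
theorem evalMap_diff (hF : EdgeSystem G F) {j : ℕ} (hj : j + 3 = 2 * Fintype.card V)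
    {f : Cochain G ℤ (TruncPoly 3)} (hf : f ∈ cochains G 3 0 j) :
    evalMap F G (diff G ℤ (TruncPoly 3) ν f) = 0 := by
  have hs : f = Pi.single ∅ (f ∅) := by
    funext s
    by_cases h : s = ∅
    · subst h; rw [Pi.single_eq_same]
    · rw [Pi.single_eq_of_ne h]
      exact (hf s).2 (by rwa [Ne, Finset.card_eq_zero])
  have hg := (hf ∅).1
  rw [hs]
  generalize f ∅ = y at hg
  rw [gradedPart_eq_span] at hg
  induction hg using Submodule.span_induction with
  | mem y hy =>
    obtain ⟨w, hw, rfl⟩ := hy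
    rw [mono_empty]
    rw [sum_comp_empty] at hw
    generalize (fun v => w (compOf ∅ v)) = W at hw
    by_cases h3 : ∃ v, 3 ≤ W v
    · obtain ⟨v, hv⟩ := h3
      have : vmono G W = 0 := by
        refine mono_eq_zero (compOf _ v) ?_
        rwa [surjInv_compOf]
      rw [this, Pi.single_zero, map_zero, map_zero]
    · push Not at h3
      rcases exists_of_sum_add_three (fun v => Nat.lt_succ_iff.1 (h3 v)) (hw ▸ hj) with
        ⟨a, b, hab, rfl⟩ | ⟨a, b, c, hab, hbc, hac, rfl⟩
      · rw [diff_vmono_pair ν hab, map_sum]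
        simp only [evalMap_edgeCochain hF]
        exact hF.pair a b hab
      · rw [diff_vmono_triple ν hab hbc hac, map_add, map_add]
        simp only [evalMap_edgeCochain hF]
        exact hF.triple a b c hab hbc hac
  | zero => rw [Pi.single_zero, map_zero, map_zero]
  | add x y _ _ hx hy => rw [Pi.single_add, map_add, map_add, hx, hy, add_zero]
  | smul r x _ hx => rw [Pi.single_smul, map_smul, map_smul, hx, smul_zero]

end Evaluation

theorem card_comp_singleton (e : G.edgeSet) :
    Fintype.card (Comp G {e}) + 1 = Fintype.card V := by
  obtain ⟨e, he⟩ := e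
  induction e with | _ p q
  have hb : Function.Bijective
      (fun v : ({q}ᶜ : Finset V) => compOf {(⟨s(p, q), he⟩ : G.edgeSet)} v.1) := by
    constructor
    · rintro ⟨x, hx⟩ ⟨y, hy⟩ h
      have := (compOf_singleton_eq_iff he).1 h
      simp only [Finset.mem_compl, Finset.mem_singleton] at hx hy
      grind
    · intro c
      obtain ⟨v, rfl⟩ := compOf_surjective _ c
      by_cases hv : v = q
      · exact ⟨⟨p, by simpa using SimpleGraph.Adj.ne he⟩,
          (compOf_singleton_eq_iff he).2 (Or.inr ⟨Or.inl rfl, Or.inr hv⟩)⟩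
      · exact ⟨⟨v, by simpa using hv⟩, rfl⟩
  rw [← Fintype.card_of_bijective hb, Fintype.card_coe, Finset.card_compl, Finset.card_singleton]
  have : 0 < Fintype.card V := Fintype.card_pos_iff.2 ⟨q⟩
  omega

/-! ### Generators, cocycles and the universal property -/

section Degree

variable {j : ℕ}

theorem edgeCochain_mem (hj : j + 3 = 2 * Fintype.card V) (e : Sym2 V) (z : V) :
    edgeCochain G e z ∈ cochains G 3 1 j := by
  rw [edgeCochain]
  split_ifs with he
  swap
  · exact zero_mem _
  intro s
  by_cases hs : s = {⟨e, he⟩}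
  · subst hs
    rw [edgeSingle_same]
    refine ⟨mono_mem ?_, fun h => (h (Finset.card_singleton _)).elim⟩
    have h1 : ∀ c : Comp G {(⟨e, he⟩ : G.edgeSet)}, (if c = compOf _ z then 1 else 2) +
        (if c = compOf _ z then 1 else 0) = 2 := fun c => by split_ifs <;> rfl
    have h2 := Finset.sum_congr (rfl : (Finset.univ : Finset (Comp G {(⟨e, he⟩ : G.edgeSet)})) = _)
      fun c _ => h1 c
    rw [Finset.sum_add_distrib, Finset.sum_ite_eq' Finset.univ, if_pos (Finset.mem_univ _),
      Finset.sum_const, Finset.card_univ, smul_eq_mul] at h2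
    have h3 := card_comp_singleton (⟨e, he⟩ : G.edgeSet)
    omega
  · rw [edgeSingle_of_ne hs]
    exact ⟨zero_mem _, fun _ => rfl⟩

/-- With `|V| - 1` components the maximal degree is `2|V| - 2 = j + 1`, so a nonzero monomial has
exponent 1 at one component and 2 at all others. -/
theorem cochains_one_le_span (hj : j + 3 = 2 * Fintype.card V) : cochains G 3 1 j ≤
    Submodule.span ℤ (Set.range fun p : Sym2 V × V => edgeCochain G p.1 p.2) := by
  intro f hf
  have hs : f = ∑ e : G.edgeSet, edgeSingle e (f {e}) := by
    funext s
    rw [Finset.sum_apply]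
    by_cases h : ∃ e, s = {e}
    · obtain ⟨e, rfl⟩ := h
      rw [Finset.sum_eq_single e, edgeSingle_same]
      · intro e' _ he'
        rw [edgeSingle_of_ne]
        simpa using he'.symm
      · simp
    · rw [(hf s).2 (by rwa [Ne, Finset.card_eq_one]), Finset.sum_eq_zero]
      intro e _
      rw [edgeSingle_of_ne]
      exact fun h' => h ⟨e, h'⟩
  rw [hs]
  refine Submodule.sum_mem _ fun e _ => ?_
  have hg := (hf {e}).1
  generalize f {e} = y at hg
  rw [gradedPart_eq_span] at hg
  induction hg using Submodule.span_induction with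
  | mem y hy =>
    obtain ⟨w, hw, rfl⟩ := hy
    by_cases h3 : ∃ c, 3 ≤ w c
    · obtain ⟨c, hc⟩ := h3
      rw [mono_eq_zero c hc, edgeSingle_zero]
      exact zero_mem _
    · push Not at h3
      have hd : ∑ c, (2 - w c) = 1 := by
        have : ∑ c, (2 - w c) + ∑ c, w c = 2 * Fintype.card (Comp G {e}) := by
          rw [← Finset.sum_add_distrib, Finset.sum_congr rfl
            fun v _ => Nat.sub_add_cancel (Nat.lt_succ_iff.1 (h3 v))]
          simp [mul_comm]
        have := card_comp_singleton e
        omega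
      obtain ⟨c, -, hc1, hc2⟩ := exists_eq_one_of_sum_eq_one hd
      obtain ⟨z, rfl⟩ := compOf_surjective _ c
      refine Submodule.subset_span ⟨(e.1, z), ?_⟩
      simp only [edgeCochain, dif_pos e.2, edgeMono]
      congr 2
      funext c
      split_ifs with h
      · have h' : c = compOf {e} z := h
        rw [h']
        omega
      · have := hc2 c (Finset.mem_univ c) h
        have := h3 c
        omega
  | zero => rw [edgeSingle_zero]; exact zero_mem _
  | add x y _ _ hx hy => rw [edgeSingle_add]; exact add_mem hx hy
  | smul r x _ hx => rw [edgeSingle_smul]; exact Submodule.smul_mem _ _ hx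

/-- A state with two edges has at most `|V| - 2` components, and its maximal degree `2|V| - 4` is
less than `j`. -/
theorem cochains_one_le_cocycles (hj : j + 3 = 2 * Fintype.card V) :
    cochains G 3 1 j ≤ cocycles G 3 ν 1 j := by
  refine le_inf le_rfl fun f hf => ?_
  rw [LinearMap.mem_ker]
  funext t
  refine diff_apply_eq_zero ν fun s hs hc => ?_
  by_cases h1 : s.card = 1
  · have := card_comp_add_two_le (G := G) (t := t) (by omega)
    exact merge_eq_zero hs (by omega) (hf s).1
  · rw [(hf s).2 h1, map_zero]

/-- The class of `edgeCochain G e z` in the first cohomology. -/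
def edgeClass (hj : j + 3 = 2 * Fintype.card V) (e : Sym2 V) (z : V) : cohomology G 3 ν 1 j :=
  Submodule.mkQ _ ⟨edgeCochain G e z, cochains_one_le_cocycles ν hj (edgeCochain_mem hj e z)⟩

theorem diff_mem_coboundaries {W : V → ℕ} (hW : ∑ v, W v = j) :
    diff G ℤ (TruncPoly 3) ν (Pi.single ∅ (vmono G W)) ∈ coboundaries G 3 ν 1 j := by
  refine Submodule.mem_map_of_mem fun s => ?_
  by_cases hs : s = ∅
  · subst hs
    rw [Pi.single_eq_same]
    exact ⟨vmono_mem hW, fun h => (h rfl).elim⟩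
  · rw [Pi.single_eq_of_ne hs]
    exact ⟨zero_mem _, fun _ => rfl⟩

theorem edgeSystem_edgeClass (hj : j + 3 = 2 * Fintype.card V) :
    EdgeSystem G (edgeClass (G := G) ν hj) where
  supp e z he := by
    have : edgeClass (G := G) ν hj e z = Submodule.mkQ _ 0 := by
      rw [edgeClass]; congr 2; exact edgeCochain_of_notMem he z
    rw [this, map_zero]
  ends x y := by
    rw [edgeClass, edgeClass]
    congr 2
    rw [edgeCochain, edgeCochain]
    split_ifs with h
    · rw [edgeMono, edgeMono, compOf_eq_of_mem h (Finset.mem_singleton_self _)]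
    · rfl
  pair a b hab := by
    simp only [edgeClass]
    rw [← map_sum, Submodule.mkQ_apply, Submodule.Quotient.mk_eq_zero, Submodule.submoduleOf,
      Submodule.mem_comap, Submodule.subtype_apply]
    rw [AddSubmonoidClass.coe_finsetSum, ← diff_vmono_pair ν hab]
    apply diff_mem_coboundaries ν
    have h1 : ∀ v : V, (if v = a then 0 else if v = b then 1 else 2) +
        ((if v = a then 2 else 0) + if v = b then 1 else 0) = 2 := fun v => by grind
    have h2 := Finset.sum_congr (rfl : (Finset.univ : Finset V) = _) fun v _ => h1 v
    simp only [Finset.sum_add_distrib, Finset.sum_ite_eq', Finset.mem_univ, if_true,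
      Finset.sum_const, Finset.card_univ, smul_eq_mul] at h2
    omega
  triple a b c hab hbc hac := by
    simp only [edgeClass]
    rw [← map_add, ← map_add, Submodule.mkQ_apply, Submodule.Quotient.mk_eq_zero,
      Submodule.submoduleOf,
      Submodule.mem_comap, Submodule.subtype_apply]
    simp only [Submodule.coe_add]
    rw [← diff_vmono_triple ν hab hbc hac]
    apply diff_mem_coboundaries ν
    have h1 : ∀ v : V, (if v = a ∨ v = b ∨ v = c then 1 else 2) +
        ((if v = a then 1 else 0) + ((if v = b then 1 else 0) + if v = c then 1 else 0)) = 2 :=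
      fun v => by grind
    have h2 := Finset.sum_congr (rfl : (Finset.univ : Finset V) = _) fun v _ => h1 v
    simp only [Finset.sum_add_distrib, Finset.sum_ite_eq', Finset.mem_univ, if_true,
      Finset.sum_const, Finset.card_univ, smul_eq_mul] at h2
    omega

/-- A group with a universal solution of the relations is isomorphic to the first cohomology. -/
theorem nonempty_cohomology_equiv (hj : j + 3 = 2 * Fintype.card V)
    {T : Type} [AddCommGroup T] {F : Sym2 V → V → T}
    (hF : EdgeSystem G F)
    (hlift : ∀ (M : Type) [AddCommGroup M] (F' : Sym2 V → V → M), EdgeSystem G F' →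
      ∃ φ : T →+ M, ∀ e z, φ (F e z) = F' e z)
    (hext : ∀ ψ : T →+ T, (∀ e z, ψ (F e z) = F e z) → ψ = AddMonoidHom.id T) :
    Nonempty (cohomology G 3 ν 1 j ≃+ T) := by
  obtain ⟨φ, hφ⟩ := hlift _ _ (edgeSystem_edgeClass ν hj)
  let f : cohomology G 3 ν 1 j →ₗ[ℤ] T :=
    Submodule.liftQ _ ((evalMap F G).comp (cocycles G 3 ν 1 j).subtype) (by
      rintro ⟨x, hx⟩ hx'
      obtain ⟨y, hy, rfl⟩ := hx'
      exact evalMap_diff ν hF hj hy)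
  -- The maps `f` and `φ` exchange `F e z` and the class of `edgeCochain G e z`. Then `hext` makes
  -- `f ∘ φ` the identity, and the spanning by edge cochains does so for `φ ∘ f`.
  have hf : ∀ e z, f (edgeClass ν hj e z) = F e z := fun e z => evalMap_edgeCochain hF e z
  have h1 : ∀ x, f (φ x) = x := by
    intro x
    have := hext (f.toAddMonoidHom.comp φ) fun e z => by
      simp only [AddMonoidHom.comp_apply, hφ]
      exact hf e z
    exact DFunLike.congr_fun this x
  have h2 : ∀ x, φ (f x) = x := by
    have hspan : Submodule.span ℤ (Set.range fun p : Sym2 V × V => edgeCochain G p.1 p.2) ≤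
        cocycles G 3 ν 1 j := by
      rw [Submodule.span_le]
      rintro _ ⟨p, rfl⟩
      exact cochains_one_le_cocycles ν hj (edgeCochain_mem hj _ _)
    have key : ∀ x : Cochain G ℤ (TruncPoly 3),
        x ∈ Submodule.span ℤ (Set.range fun p : Sym2 V × V => edgeCochain G p.1 p.2) →
        ∀ hx : x ∈ cocycles G 3 ν 1 j, φ (f (Submodule.mkQ _ ⟨x, hx⟩)) =
          (Submodule.mkQ _ ⟨x, hx⟩ : cohomology G 3 ν 1 j) := by
      intro x hx
      induction hx using Submodule.span_induction with
      | mem x hx =>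
        obtain ⟨p, rfl⟩ := hx
        intro hx
        exact (congrArg φ (hf p.1 p.2)).trans (hφ p.1 p.2)
      | zero =>
        intro hx
        have : (⟨0, hx⟩ : cocycles G 3 ν 1 j) = 0 := rfl
        rw [this, map_zero, map_zero, map_zero]
      | add x y hx hy ihx ihy =>
        intro hxy
        have : (⟨x + y, hxy⟩ : cocycles G 3 ν 1 j) = ⟨x, hspan hx⟩ + ⟨y, hspan hy⟩ := rfl
        rw [this, map_add, map_add, map_add, ihx, ihy]
      | smul r x hx ihx =>
        intro hrx
        have : (⟨r • x, hrx⟩ : cocycles G 3 ν 1 j) = r • ⟨x, hspan hx⟩ := rfl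
        rw [this, map_smul, map_smul, map_zsmul, ihx]
    intro x
    obtain ⟨⟨x, hx⟩, rfl⟩ := Submodule.mkQ_surjective _ x
    exact key x (cochains_one_le_span hj hx.1) hx
  exact ⟨{ f.toAddMonoidHom with
    invFun := φ
    left_inv := h2
    right_inv := h1 }⟩

end Degree

end FirstCohomology

/-! ### Systems on edges and third vertices; local solutions on triangles and four-cycles -/

section PathSystems

open Classical

variable {V : Type} [Fintype V] {M : Type*} [AddCommGroup M]

/-- The relations of the first cohomology, without the symmetry of the row sums, for a family
`F x y z` of values on the edges `x y` and the third vertices `z`. -/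
structure PreSystem (G : SimpleGraph V) (F : V → V → V → M) : Prop where
  symm : ∀ x y z, F x y z = F y x z
  supp : ∀ x y z, ¬G.Adj x y → F x y z = 0
  ends : ∀ x y, F x y x = 0
  cyclic : ∀ x y z, F x y z + F y z x + F z x y = 0
  row : ∀ x z, x ≠ z → ¬G.Adj x z → ∑ y, F x y z = 0

/-- The relations of the first cohomology for a family `F x y z` of values on the edges `x y` and
the third vertices `z`. The value for an edge `x y` and the component of the edge itself is then
the negative of the row sum. -/
structure System (G : SimpleGraph V) (F : V → V → V → M) : Prop extends PreSystem G F where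
  rowSymm : ∀ x z, ∑ y, F x y z = ∑ y, F z y x

variable {G : SimpleGraph V} {F : V → V → V → M}

/-- The family on edges and vertices that is given by a solution of the relations. -/
def System.toEdge (hF : System G F) : Sym2 V → V → M :=
  Sym2.lift ⟨fun x y z => if z = x ∨ z = y then (if G.Adj x y then -∑ c, F x c y else 0)
    else F x y z, fun x y => by
      funext z
      simp only [or_comm (a := z = x), G.adj_comm x y, hF.rowSymm x y, hF.symm x y z]⟩

theorem System.toEdge_mk (hF : System G F) (x y z : V) : hF.toEdge s(x, y) z =
    if z = x ∨ z = y then (if G.Adj x y then -∑ c, F x c y else 0) else F x y z := rfl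

/-- In the relation `pair` for an edge `a b`, the term `c = b` was defined to cancel the row sum;
for nonadjacent `a`, `b` the relation is `row`. The symmetry of the row sums makes the definition
independent of the chosen end. -/
theorem System.edgeSystem (hF : System G F) : EdgeSystem G hF.toEdge where
  supp e z he := by
    induction e with | _ x y
    have he' : ¬G.Adj x y := he
    rw [hF.toEdge_mk, if_neg he', hF.supp x y z he', ite_self]
  ends x y := by simp [hF.toEdge_mk]
  pair a b hab := by
    have h : ∀ c, hF.toEdge s(a, c) b = F a c b +
        if c = b then (if G.Adj a b then -∑ c, F a c b else 0) else 0 := by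
      intro c
      rw [hF.toEdge_mk]
      by_cases hcb : c = b
      · subst hcb
        rw [if_pos (Or.inr rfl), if_pos rfl, hF.symm, hF.ends, zero_add]
      · rw [if_neg (by grind), if_neg hcb, add_zero]
    simp only [h, Finset.sum_add_distrib, Finset.sum_ite_eq', Finset.mem_univ, if_true]
    split_ifs with hadj
    · rw [add_neg_cancel]
    · rw [hF.row a b hab hadj, add_zero]
  triple a b c hab hbc hac := by
    rw [hF.toEdge_mk, hF.toEdge_mk, hF.toEdge_mk, if_neg (by grind), if_neg (by grind),
      if_neg (by grind), hF.symm a c b]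
    exact hF.cyclic a b c

theorem EdgeSystem.apply_self {F : Sym2 V → V → M} (hF : EdgeSystem G F) {x y : V}
    (hxy : x ≠ y) :
    F s(x, y) y = -∑ c, if y = x ∨ y = c then 0 else F s(x, c) y := by
  have h : ∀ c, F s(x, c) y = (if y = x ∨ y = c then 0 else F s(x, c) y) +
      if c = y then F s(x, y) y else 0 := by
    intro c
    by_cases hc : c = y
    · subst hc
      simp
    · rw [if_neg (by grind), if_neg hc, add_zero]
  have h0 := hF.pair x y hxy
  rw [Finset.sum_congr rfl fun c _ => h c, Finset.sum_add_distrib, Finset.sum_ite_eq',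
    if_pos (Finset.mem_univ y)] at h0
  exact eq_neg_of_add_eq_zero_right h0

/-- Symmetry holds because the row sums at `(x, z)` and `(z, x)` are both minus the one value of
`s(x, z)` at its own component. -/
theorem EdgeSystem.system {F : Sym2 V → V → M} (hF : EdgeSystem G F) :
    System G fun x y z => if z = x ∨ z = y then 0 else F s(x, y) z where
  symm x y z := by simp only [or_comm (a := z = x), Sym2.eq_swap (a := x)]
  supp x y z h := by rw [hF.supp s(x, y) z h, ite_self]
  ends x y := by simp
  cyclic x y z := by
    by_cases h : x = y ∨ y = z ∨ x = z
    · rcases h with rfl | rfl | rfl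
      · have := hF.supp s(x, x) z (by simp)
        simp [this]
      · have := hF.supp s(y, y) x (by simp)
        simp [this]
      · have := hF.supp s(x, x) y (by simp)
        simp [this]
    · rw [if_neg (by grind), if_neg (by grind), if_neg (by grind), Sym2.eq_swap (a := z)]
      apply hF.triple <;> grind
  row x z hxz hadj := by
    refine (Finset.sum_congr rfl fun y _ => ?_).trans (hF.pair x z hxz)
    split_ifs with h
    · rcases h with rfl | rfl
      · exact (hxz rfl).elim
      · exact (hF.supp s(x, z) z hadj).symm
    · rfl
  rowSymm x z := by
    by_cases hxz : x = z
    · rw [hxz]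
    have h1 := hF.apply_self hxz
    have h2 := hF.apply_self (Ne.symm hxz)
    rw [Sym2.eq_swap, hF.ends, h1] at h2
    exact neg_injective h2

theorem System.comp_iso {W : Type} [Fintype W] {G' : SimpleGraph W} (i : G' ≃g G)
    (hF : System G F) : System G' fun x y z => F (i x) (i y) (i z) where
  symm x y z := hF.symm _ _ _
  supp x y z h := hF.supp _ _ _ (by rwa [i.map_adj_iff])
  ends x y := hF.ends _ _
  cyclic x y z := hF.cyclic _ _ _
  row x z hxz h := by
    rw [← hF.row (i x) (i z) (by simpa using hxz) (by rwa [i.map_adj_iff])]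
    exact i.toEquiv.sum_comp fun y => F (i x) y (i z)
  rowSymm x z := by
    have h1 := i.toEquiv.sum_comp fun y => F (i x) y (i z)
    have h2 := i.toEquiv.sum_comp fun y => F (i z) y (i x)
    exact h1.trans ((hF.rowSymm _ _).trans h2.symm)

/-- A group with a universal solution of the relations on a graph that is isomorphic to `G` is
isomorphic to the first cohomology of `G`. -/
theorem nonempty_cohomology_equiv_of_system (ν : G.edgeSet ↪ ℕ) {j : ℕ}
    (hj : j + 3 = 2 * Fintype.card V) {W : Type} [Fintype W] {G' : SimpleGraph W} (i : G ≃g G')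
    {T : Type} [AddCommGroup T] {F : W → W → W → T} (hF : System G' F)
    (hlift : ∀ (M : Type) [AddCommGroup M] (F' : W → W → W → M), System G' F' →
      ∃ φ : T →+ M, ∀ x y z, φ (F x y z) = F' x y z)
    (hext : ∀ ψ : T →+ T, (∀ x y z, ψ (F x y z) = F x y z) → ψ = AddMonoidHom.id T) :
    Nonempty (cohomology G 3 ν 1 j ≃+ T) := by
  refine nonempty_cohomology_equiv ν hj (hF.comp_iso i).edgeSystem ?_ ?_
  · intro M _ F' hF'
    obtain ⟨φ, hφ⟩ := hlift M _ (hF'.system.comp_iso i.symm)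
    simp only [EmbeddingLike.apply_eq_iff_eq] at hφ
    refine ⟨φ, fun e z => ?_⟩
    induction e with | _ x y
    rw [System.toEdge_mk]
    by_cases hxy : G.Adj x y
    · have hend : φ (-∑ c, F (i x) (i c) (i y)) = F' s(x, y) y := by
        rw [hF'.apply_self hxy.ne, map_neg, map_sum]
        simp [hφ]
      rw [if_pos hxy]
      split_ifs with h
      · rw [hend]
        rcases h with rfl | rfl
        · exact (hF'.ends _ _).symm
        · rfl
      · rw [hφ]
        simp [h]
    · rw [if_neg hxy, (hF.comp_iso i).supp x y z hxy, ite_self, map_zero, hF'.supp _ _ hxy]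
  · intro ψ hψ
    refine hext ψ fun x y z => ?_
    have hs := hF.comp_iso i
    have key : ∀ x y z, ψ (F (i x) (i y) (i z)) = F (i x) (i y) (i z) := by
      intro x y z
      have := hψ s(x, y) z
      rw [System.toEdge_mk] at this
      by_cases h : z = x ∨ z = y
      · have h0 : F (i x) (i y) (i z) = 0 := by
          rcases h with rfl | rfl
          · exact hF.ends _ _
          · rw [hF.symm]; exact hF.ends _ _
        rw [h0, map_zero]
      · rwa [if_neg h] at this
    simpa using key (i.symm x) (i.symm y) (i.symm z)

variable (G M) in
/-- The group of solutions of the relations without the symmetry of the row sums. -/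
def preSystems : AddSubgroup (V → V → V → M) where
  carrier := {F | PreSystem G F}
  zero_mem' := ⟨by simp, by simp, by simp, by simp, by simp⟩
  add_mem' {F F'} h h' :=
    { symm := fun x y z => congrArg₂ (· + ·) (h.symm x y z) (h'.symm x y z)
      supp := fun x y z hxy => by simp [h.supp x y z hxy, h'.supp x y z hxy]
      ends := fun x y => by simp [h.ends, h'.ends]
      cyclic := fun x y z => by
        have h1 := h.cyclic x y z
        have h2 := h'.cyclic x y z
        simp only [Pi.add_apply]
        rw [← add_zero (0 : M)]
        nth_rw 1 [← h1]
        rw [← h2]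
        abel
      row := fun x z hxz hadj => by
        simp [Finset.sum_add_distrib, h.row x z hxz hadj, h'.row x z hxz hadj] }
  neg_mem' {F} h :=
    { symm := fun x y z => congrArg Neg.neg (h.symm x y z)
      supp := fun x y z hxy => by simp [h.supp x y z hxy]
      ends := fun x y => by simp [h.ends]
      cyclic := fun x y z => by
        have h1 := congrArg Neg.neg (h.cyclic x y z)
        simp only [neg_add, neg_zero] at h1
        exact h1
      row := fun x z hxz hadj => by simp [h.row x z hxz hadj] }

theorem mem_preSystems : F ∈ preSystems M G ↔ PreSystem G F := Iff.rfl

/-- The antisymmetric function on ordered pairs with value `m` at `(p, q)`. -/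
def dart (p q : V) : M →+ (V → V → M) where
  toFun m x z := (if x = p ∧ z = q then m else 0) - (if x = q ∧ z = p then m else 0)
  map_zero' := by funext x z; simp
  map_add' m m' := by
    funext x z
    simp only [Pi.add_apply]
    split_ifs <;> abel

omit [Fintype V] in
theorem dart_apply (p q : V) (m : M) (x z : V) : dart p q m x z =
    (if x = p ∧ z = q then m else 0) - (if x = q ∧ z = p then m else 0) := rfl

omit [Fintype V] in
theorem dart_swap (p q : V) (m : M) : dart q p m = -dart p q m := by
  funext x z
  simp only [dart_apply, Pi.neg_apply, neg_sub]

/-- The antisymmetrization of the row sums. -/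
def asym : (V → V → V → M) →+ (V → V → M) where
  toFun F x z := ∑ y, F x y z - ∑ y, F z y x
  map_zero' := by funext x z; simp
  map_add' F F' := by
    funext x z
    simp only [Pi.add_apply, Finset.sum_add_distrib]
    abel

theorem asym_apply (F : V → V → V → M) (x z : V) :
    asym F x z = ∑ y, F x y z - ∑ y, F z y x := rfl

theorem PreSystem.system_of_asym (hF : PreSystem G F) (h : asym F = 0) : System G F :=
  { hF with rowSymm := fun x z => sub_eq_zero.1 (congrFun (congrFun h x) z) }

theorem System.asym_eq_zero (hF : System G F) : asym F = 0 := by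
  funext x z
  exact sub_eq_zero.2 (hF.rowSymm x z)

/-- The family that is supported on the path `p q r`, with value `m` at the edge `p q` and `-m` at
the edge `q r`. -/
def pathFn (p q r : V) : M →+ (V → V → V → M) where
  toFun m x y z := (if x = p ∧ y = q ∧ z = r then m else 0) +
    (if y = p ∧ x = q ∧ z = r then m else 0) - (if z = p ∧ y = q ∧ x = r then m else 0) -
    (if z = p ∧ x = q ∧ y = r then m else 0)
  map_zero' := by funext x y z; simp
  map_add' m m' := by
    funext x y z
    simp only [Pi.add_apply]
    split_ifs <;> abel

omit [Fintype V] in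
theorem pathFn_apply (p q r : V) (m : M) (x y z : V) : pathFn p q r m x y z =
    (if x = p ∧ y = q ∧ z = r then m else 0) +
    (if y = p ∧ x = q ∧ z = r then m else 0) - (if z = p ∧ y = q ∧ x = r then m else 0) -
    (if z = p ∧ x = q ∧ y = r then m else 0) := rfl

theorem sum_pathFn (p q r : V) (m : M) (x z : V) : ∑ y, pathFn p q r m x y z =
    (if x = p ∧ z = r then m else 0) + (if x = q ∧ z = r then m else 0) -
    (if x = r ∧ z = p then m else 0) - (if x = q ∧ z = p then m else 0) := by
  have h : ∀ (P : Prop) [Decidable P] (a : V), ∑ y, (if y = a ∧ P then m else 0) =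
      if P then m else 0 := by
    intro P _ a
    by_cases hP : P <;> simp [hP]
  simp only [pathFn_apply, Finset.sum_add_distrib, Finset.sum_sub_distrib]
  have e1 : ∑ y, (if x = p ∧ y = q ∧ z = r then m else 0) = if x = p ∧ z = r then m else 0 :=
    (Finset.sum_congr rfl fun y _ => if_congr
      (show _ ↔ y = q ∧ x = p ∧ z = r by tauto) rfl rfl).trans (h (x = p ∧ z = r) q)
  have e2 : ∑ y, (if y = p ∧ x = q ∧ z = r then m else 0) = if x = q ∧ z = r then m else 0 :=
    h _ p
  have e3 : ∑ y, (if z = p ∧ y = q ∧ x = r then m else 0) = if x = r ∧ z = p then m else 0 :=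
    (Finset.sum_congr rfl fun y _ => if_congr
      (show _ ↔ y = q ∧ x = r ∧ z = p by tauto) rfl rfl).trans (h (x = r ∧ z = p) q)
  have e4 : ∑ y, (if z = p ∧ x = q ∧ y = r then m else 0) = if x = q ∧ z = p then m else 0 :=
    (Finset.sum_congr rfl fun y _ => if_congr
      (show _ ↔ y = r ∧ x = q ∧ z = p by tauto) rfl rfl).trans (h (x = q ∧ z = p) r)
  rw [e1, e2, e3, e4]

/-- The row sums are `m` at `(p, r)` and `(q, r)` and `-m` at `(r, p)` and `(q, p)`, so
antisymmetrization doubles the contribution of the pair `p, r`. -/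
theorem asym_pathFn (p q r : V) (m : M) :
    asym (pathFn p q r m) = 2 • dart p r m + dart q r m + dart p q m := by
  funext x z
  rw [asym_apply, sum_pathFn, sum_pathFn]
  simp only [Pi.add_apply, dart_apply, two_nsmul]
  simp only [and_comm (a := z = p) (b := x = r), and_comm (a := z = q) (b := x = r),
    and_comm (a := z = r) (b := x = p), and_comm (a := z = q) (b := x = p)]
  abel

omit [Fintype V] in
theorem pathFn_symm (p q r : V) (m : M) (x y z : V) :
    pathFn p q r m x y z = pathFn p q r m y x z := by
  simp only [pathFn_apply]
  abel

omit [Fintype V] in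
theorem pathFn_cyclic (p q r : V) (m : M) (x y z : V) :
    pathFn p q r m x y z + pathFn p q r m y z x + pathFn p q r m z x y = 0 := by
  simp only [pathFn_apply]
  abel

omit [Fintype V] in
theorem pathFn_supp {p q r : V} (h1 : G.Adj p q) (h2 : G.Adj q r) (m : M) (x y z : V)
    (h : ¬G.Adj x y) : pathFn p q r m x y z = 0 := by
  have h3 := h1.symm
  have h4 := h2.symm
  rw [pathFn_apply, if_neg (by grind), if_neg (by grind), if_neg (by grind), if_neg (by grind)]
  abel

omit [Fintype V] in
theorem pathFn_ends {p q r : V} (h1 : G.Adj p q) (h2 : G.Adj q r) (h3 : p ≠ r) (m : M)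
    (x y : V) : pathFn p q r m x y x = 0 := by
  have h1 := h1.ne
  have h2 := h2.ne
  simp only [pathFn_apply]
  split_ifs <;> grind

/-- On a triangle, all pairs with a nonzero row sum are adjacent, where `row` demands nothing. -/
theorem preSystem_pathFn {p q r : V} (h1 : G.Adj p q) (h2 : G.Adj q r) (h3 : G.Adj p r) (m : M) :
    PreSystem G (pathFn p q r m) where
  symm := pathFn_symm p q r m
  supp := pathFn_supp h1 h2 m
  ends := pathFn_ends h1 h2 h3.ne m
  cyclic := pathFn_cyclic p q r m
  row x z _ h := by
    have h1' := h1.symm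
    have h2' := h2.symm
    have h3' := h3.symm
    rw [sum_pathFn, if_neg (by grind), if_neg (by grind), if_neg (by grind), if_neg (by grind)]
    abel

/-- The family that is supported on the four-cycle `p q r s`, with value `m` at the edge `p q` and
the vertex `r`. -/
def cycleFn (p q r s : V) : M →+ (V → V → V → M) := pathFn p q r - pathFn p s r

omit [Fintype V] in
theorem cycleFn_apply (p q r s : V) (m : M) :
    cycleFn p q r s m = pathFn p q r m - pathFn p s r m := rfl

/-- The doubled diagonal terms of the two paths from `p` to `r` cancel, and the oriented boundary of
the four-cycle remains. -/
theorem asym_cycleFn (p q r s : V) (m : M) :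
    asym (cycleFn p q r s m) = dart p q m + dart q r m + dart r s m + dart s p m := by
  rw [cycleFn_apply, map_sub, asym_pathFn, asym_pathFn, dart_swap s r, dart_swap p s]
  abel

/-- The diagonal `p r` need not be an edge: the row sums of the two paths cancel there. -/
theorem preSystem_cycleFn {p q r s : V} (h1 : G.Adj p q) (h2 : G.Adj q r) (h3 : G.Adj r s)
    (h4 : G.Adj s p) (hpr : p ≠ r) (m : M) : PreSystem G (cycleFn p q r s m) where
  symm x y z := by simp only [cycleFn_apply, Pi.sub_apply, pathFn_symm _ _ _ _ x y]
  supp x y z h := by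
    simp [cycleFn_apply, pathFn_supp h1 h2 m x y z h, pathFn_supp h4.symm h3.symm m x y z h]
  ends x y := by
    simp [cycleFn_apply, pathFn_ends h1 h2 hpr m x y, pathFn_ends h4.symm h3.symm hpr m x y]
  cyclic x y z := by
    have h := congrArg₂ (· - ·) (pathFn_cyclic p q r m x y z) (pathFn_cyclic p s r m x y z)
    simp only [sub_zero] at h
    rw [← h]
    simp only [cycleFn_apply, Pi.sub_apply]
    abel
  row x z _ h := by
    simp only [cycleFn_apply, Pi.sub_apply, Finset.sum_sub_distrib, sum_pathFn]
    have h1' := h1.symm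
    have h2' := h2.symm
    have h3' := h3.symm
    have h4' := h4.symm
    rw [if_neg (show ¬(x = q ∧ z = r) by grind), if_neg (show ¬(x = q ∧ z = p) by grind),
      if_neg (show ¬(x = s ∧ z = r) by grind), if_neg (show ¬(x = s ∧ z = p) by grind)]
    abel

/-- Two common neighbours of nonadjacent vertices, if there are no others. -/
theorem PreSystem.add_eq_zero (hF : PreSystem G F) {x z a b : V} (hxz : x ≠ z)
    (h : ¬G.Adj x z) (hab : a ≠ b) (hc : ∀ c, G.Adj x c → G.Adj c z → c = a ∨ c = b) :
    F x a z + F x b z = 0 := by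
  rw [← hF.row x z hxz h, ← Finset.sum_pair hab (f := fun c => F x c z)]
  refine Finset.sum_subset (Finset.subset_univ _) fun c _ hcab => ?_
  by_cases hxc : G.Adj x c
  swap
  · exact hF.supp _ _ _ hxc
  by_cases hcz : G.Adj c z
  · have := hc c hxc hcz
    simp only [Finset.mem_insert, Finset.mem_singleton] at hcab
    exact (hcab this).elim
  have := hF.cyclic x c z
  rwa [hF.supp c z x hcz, hF.supp z x c (fun h' => h h'.symm), add_zero, add_zero] at this

theorem PreSystem.eq_zero_of_unique (hF : PreSystem G F) {x z a : V} (hxz : x ≠ z)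
    (h : ¬G.Adj x z) (hc : ∀ c, G.Adj x c → G.Adj c z → c = a) : F x a z = 0 := by
  -- The vertex `x` itself serves as the second neighbour, since `F x x z = 0`.
  have := hF.add_eq_zero hxz h (a := a) (b := x)
  by_cases hax : a = x
  · subst hax; exact hF.supp _ _ _ (by simp)
  · have := this hax fun c h1 h2 => Or.inl (hc c h1 h2)
    rwa [hF.supp x x z (by simp), add_zero] at this

/-- Since `z x` is not an edge, the cyclic relation has only two terms. -/
theorem PreSystem.reverse (hF : PreSystem G F) {x z : V} (h : ¬G.Adj x z) (y : V) :
    F z y x = - F x y z := by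
  have := hF.cyclic x y z
  rw [hF.supp z x y (fun h' => h h'.symm), add_zero, hF.symm y z x] at this
  rwa [eq_neg_iff_add_eq_zero, add_comm]

end PathSystems

/-! ### The square of a cycle with chords, and common neighbours in it -/

section BandGraph

/-- The adjacency of the graph on the cyclically ordered vertices `0, …, 4k + 3`, in which vertices
at distance at most two are adjacent and even vertices with sum `4k + 2` are adjacent. -/
def BandAdj (k x y : ℕ) : Prop :=
  (y = x + 1 ∨ x = y + (4 * k + 3)) ∨ (x = y + 1 ∨ y = x + (4 * k + 3)) ∨
  (y = x + 2 ∨ x = y + (4 * k + 2)) ∨ (x = y + 2 ∨ y = x + (4 * k + 2)) ∨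
  (x % 2 = 0 ∧ x + y = 4 * k + 2)

/-- The square of a cycle of length `4k + 4`, with chords that form a strip of `k` squares on the
even vertices. -/
def bandGraph (k : ℕ) : SimpleGraph (ZMod (4 * k + 4)) where
  Adj x y := BandAdj k x.val y.val
  symm := ⟨fun x y h => by unfold BandAdj at *; omega⟩
  loopless := ⟨fun x h => by unfold BandAdj at h; omega⟩

variable {k : ℕ}

theorem bandGraph_adj {x y : ZMod (4 * k + 4)} :
    (bandGraph k).Adj x y ↔ BandAdj k x.val y.val := Iff.rfl

theorem val_eq_iff {x y : ZMod (4 * k + 4)} : x = y ↔ x.val = y.val :=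
  (ZMod.val_injective _).eq_iff.symm

theorem eq_add_natCast_iff {x y : ZMod (4 * k + 4)} (c : ℕ) (hc : c < 4 * k + 4) :
    y = x + (c : ZMod (4 * k + 4)) ↔ y.val = x.val + c ∨ x.val + c = y.val + (4 * k + 4) := by
  have hx := ZMod.val_lt x
  have hy := ZMod.val_lt y
  rw [val_eq_iff, ZMod.val_add, ZMod.val_natCast, Nat.mod_eq_of_lt hc]
  by_cases h : x.val + c < 4 * k + 4
  · rw [Nat.mod_eq_of_lt h]; omega
  · rw [Nat.mod_eq_sub_mod (by omega), Nat.mod_eq_of_lt (by omega)]; omega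

theorem eq_add_one_iff {x y : ZMod (4 * k + 4)} :
    y = x + 1 ↔ y.val = x.val + 1 ∨ x.val + 1 = y.val + (4 * k + 4) := by
  have := eq_add_natCast_iff (x := x) (y := y) 1 (by omega)
  rwa [Nat.cast_one] at this

theorem eq_add_two_iff {x y : ZMod (4 * k + 4)} :
    y = x + 2 ↔ y.val = x.val + 2 ∨ x.val + 2 = y.val + (4 * k + 4) := by
  have := eq_add_natCast_iff (x := x) (y := y) 2 (by omega)
  rwa [Nat.cast_ofNat] at this

theorem eq_add_three_iff {x y : ZMod (4 * k + 4)} :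
    y = x + 3 ↔ y.val = x.val + 3 ∨ x.val + 3 = y.val + (4 * k + 4) := by
  have := eq_add_natCast_iff (x := x) (y := y) 3 (by omega)
  rwa [Nat.cast_ofNat] at this

/-- The property that three vertices form a path of length two in the `i`-th square. -/
def SquarePath (k i x y z : ℕ) : Prop :=
  (x = 2 * i ∧ y = 2 * i + 2 ∧ z + 2 * i = 4 * k) ∨
  (z = 2 * i ∧ y = 2 * i + 2 ∧ x + 2 * i = 4 * k) ∨
  (x = 2 * i ∧ y + 2 * i = 4 * k + 2 ∧ z + 2 * i = 4 * k) ∨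
  (z = 2 * i ∧ y + 2 * i = 4 * k + 2 ∧ x + 2 * i = 4 * k) ∨
  (x = 2 * i + 2 ∧ y + 2 * i = 4 * k ∧ z + 2 * i = 4 * k + 2) ∨
  (z = 2 * i + 2 ∧ y + 2 * i = 4 * k ∧ x + 2 * i = 4 * k + 2) ∨
  (x = 2 * i + 2 ∧ y = 2 * i ∧ z + 2 * i = 4 * k + 2) ∨
  (z = 2 * i + 2 ∧ y = 2 * i ∧ x + 2 * i = 4 * k + 2)

theorem common_neighbor_three {x z c : ℕ} (hx : x < 4 * k + 4) (hz : z < 4 * k + 4)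
    (hc : c < 4 * k + 4) (h : z = x + 3 ∨ x + 3 = z + (4 * k + 4)) (h1 : BandAdj k x c)
    (h2 : BandAdj k c z) :
    (c = x + 1 ∨ x + 1 = c + (4 * k + 4)) ∨ (c = x + 2 ∨ x + 2 = c + (4 * k + 4)) := by
  unfold BandAdj at *
  omega

/-- The exceptional `x` belong to the straight paths that turn round an end of the strip; they lie
in the first or the last square. -/
theorem common_neighbor_four {x y z c : ℕ} (hk : 1 < k) (hx : x < 4 * k + 4) (hy : y < 4 * k + 4)
    (hz : z < 4 * k + 4) (hc : c < 4 * k + 4) (h : y = x + 2 ∨ x + 2 = y + (4 * k + 4))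
    (h' : z = y + 2 ∨ y + 2 = z + (4 * k + 4)) (h1 : BandAdj k x c) (h2 : BandAdj k c z)
    (hcy : c ≠ y) : x = 4 * k + 2 ∨ x = 4 * k ∨ x + 2 = 2 * k ∨ x = 2 * k := by
  unfold BandAdj at *
  omega

/-- Here `x y` is an interior chord and `z` is an odd vertex next to `y`. The other neighbours of
`z` are too far from `x` along the band. -/
theorem common_neighbor_chord {x y z c : ℕ} (hk : 1 < k) (hx : x < 4 * k + 4)
    (hz : z < 4 * k + 4) (hc : c < 4 * k + 4) (hx2 : x % 2 = 0) (hxy : x + y = 4 * k + 2)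
    (hx0 : x ≠ 0) (hx0' : x ≠ 4 * k + 2) (hxk : x ≠ 2 * k) (hxk' : x ≠ 2 * k + 2)
    (h : z = y + 1 ∨ y = z + 1) (h1 : BandAdj k x c) (h2 : BandAdj k c z) : c = y := by
  unfold BandAdj at *
  omega

theorem common_neighbor_top {i c : ℕ} (hi : i < k) (hc : c < 4 * k + 4)
    (h1 : BandAdj k (2 * i) c) (h2 : BandAdj k c (4 * k - 2 * i)) :
    c = 2 * i + 2 ∨ c = 4 * k + 2 - 2 * i := by
  unfold BandAdj at *
  omega

theorem common_neighbor_bottom {i c : ℕ} (hi : i < k) (hc : c < 4 * k + 4)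
    (h1 : BandAdj k (2 * i + 2) c) (h2 : BandAdj k c (4 * k + 2 - 2 * i)) :
    c = 4 * k - 2 * i ∨ c = 2 * i := by
  unfold BandAdj at *
  omega

end BandGraph

/-! ### The local relations determine a family from its values on selected paths -/

section Vanishing

variable {k : ℕ} {M : Type*} [AddCommGroup M]
  {F : ZMod (4 * k + 4) → ZMod (4 * k + 4) → ZMod (4 * k + 4) → M}

/-- The values of a family at the paths that determine it are zero. -/
structure VanishesOnPaths (k : ℕ)
    (F : ZMod (4 * k + 4) → ZMod (4 * k + 4) → ZMod (4 * k + 4) → M) : Prop where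
  near : ∀ j, F j (j + 1) (j + 2) = 0
  far : ∀ j, F j (j + 2) (j + 1) = 0
  wide : ∀ j, F j (j + 1) (j + 3) = 0
  top : ∀ i < k, F ((2 * i : ℕ) : ZMod _) ((2 * i + 2 : ℕ) : ZMod _)
    ((4 * k - 2 * i : ℕ) : ZMod _) = 0
  bottom : ∀ i < k, F ((2 * i + 2 : ℕ) : ZMod _) ((4 * k - 2 * i : ℕ) : ZMod _)
    ((4 * k + 2 - 2 * i : ℕ) : ZMod _) = 0

theorem eq_natCast_of_val {x : ZMod (4 * k + 4)} {a : ℕ} (h : x.val = a) : x = (a : ZMod _) := by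
  rw [← h, ZMod.natCast_zmod_val]

/-- A triangle carries three values; two vanish by assumption and the third by the cyclic relation.
-/
theorem triangle_eq_zero (hF : PreSystem (bandGraph k) F) (h0 : VanishesOnPaths k F)
    {x y z : ZMod (4 * k + 4)} (j : ZMod (4 * k + 4))
    (h : (x = j ∧ y = j + 1 ∧ z = j + 2) ∨ (x = j ∧ y = j + 2 ∧ z = j + 1) ∨
      (x = j + 1 ∧ y = j ∧ z = j + 2) ∨ (x = j + 1 ∧ y = j + 2 ∧ z = j) ∨
      (x = j + 2 ∧ y = j ∧ z = j + 1) ∨ (x = j + 2 ∧ y = j + 1 ∧ z = j)) : F x y z = 0 := by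
  have h1 := h0.near j
  have h2 := h0.far j
  have h3 := hF.cyclic j (j + 1) (j + 2)
  rw [h1, hF.symm (j + 2), h2, zero_add, add_zero] at h3
  rcases h with ⟨rfl, rfl, rfl⟩ | ⟨rfl, rfl, rfl⟩ | ⟨rfl, rfl, rfl⟩ | ⟨rfl, rfl, rfl⟩ |
    ⟨rfl, rfl, rfl⟩ | ⟨rfl, rfl, rfl⟩
  · exact h1
  · exact h2
  · rw [hF.symm]; exact h1
  · exact h3
  · rw [hF.symm]; exact h2
  · rw [hF.symm]; exact h3

/-- The only common neighbours of the nonadjacent vertices `j` and `j + 3` are `j + 1` and `j + 2`,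
so the row relation makes their two values opposite. -/
theorem wide_eq_zero (hF : PreSystem (bandGraph k) F) (h0 : VanishesOnPaths k F) (hk : 1 < k)
    {x y z : ZMod (4 * k + 4)} (j : ZMod (4 * k + 4))
    (h : (x = j ∧ y = j + 1 ∧ z = j + 3) ∨ (x = j ∧ y = j + 2 ∧ z = j + 3) ∨
      (x = j + 3 ∧ y = j + 1 ∧ z = j) ∨ (x = j + 3 ∧ y = j + 2 ∧ z = j)) : F x y z = 0 := by
  have hv := eq_add_three_iff.1 (rfl : j + 3 = j + 3)
  have hj := ZMod.val_lt j
  have hj3 := ZMod.val_lt (j + 3)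
  have hne : j ≠ j + 3 := by rw [Ne, val_eq_iff]; omega
  have hadj : ¬(bandGraph k).Adj j (j + 3) := by
    rw [bandGraph_adj]; unfold BandAdj; omega
  have h12 : j + 1 ≠ j + 2 := by
    rw [Ne, val_eq_iff]
    have h1 := eq_add_one_iff.1 (rfl : j + 1 = j + 1)
    have h2 := eq_add_two_iff.1 (rfl : j + 2 = j + 2)
    omega
  have h1 := h0.wide j
  have h2 := hF.add_eq_zero hne hadj h12 fun c hc1 hc2 => by
    rw [eq_add_one_iff, eq_add_two_iff]
    exact common_neighbor_three hj hj3 (ZMod.val_lt c) hv hc1 hc2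
  rw [h1, zero_add] at h2
  rcases h with ⟨rfl, rfl, rfl⟩ | ⟨rfl, rfl, rfl⟩ | ⟨rfl, rfl, rfl⟩ | ⟨rfl, rfl, rfl⟩
  · exact h1
  · exact h2
  · rw [hF.reverse hadj, h1, neg_zero]
  · rw [hF.reverse hadj, h2, neg_zero]

theorem val_natCast_of_lt {a : ℕ} (h : a < 4 * k + 4) : (a : ZMod (4 * k + 4)).val = a :=
  ZMod.val_cast_of_lt h

/-- The corners `p` and `r` are opposite, with `q` and `s` as their only common neighbours. One
value therefore determines those of the other path and of both reversed paths. -/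
theorem square_top_values (hF : PreSystem (bandGraph k) F) (h0 : VanishesOnPaths k F)
    {p q r s : ZMod (4 * k + 4)} {i : ℕ} (hi : i < k) (vp : p.val = 2 * i)
    (vq : q.val = 2 * i + 2) (vr : r.val = 4 * k - 2 * i) (vs : s.val = 4 * k + 2 - 2 * i) :
    F p q r = 0 ∧ F r q p = 0 ∧ F p s r = 0 ∧ F r s p = 0 := by
  have npr : ¬(bandGraph k).Adj p r := by
    rw [bandGraph_adj, vp, vr]; unfold BandAdj; omega
  have h1 : F p q r = 0 := by
    rw [eq_natCast_of_val vp, eq_natCast_of_val vq, eq_natCast_of_val vr]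
    exact h0.top i hi
  have h2 := hF.add_eq_zero (x := p) (z := r) (a := q) (b := s)
    (by rw [Ne, val_eq_iff]; omega) npr (by rw [Ne, val_eq_iff]; omega) fun c hc1 hc2 => by
    rw [val_eq_iff, val_eq_iff, vq, vs]
    rw [bandGraph_adj, vp] at hc1
    rw [bandGraph_adj, vr] at hc2
    exact common_neighbor_top hi (ZMod.val_lt c) hc1 hc2
  rw [h1, zero_add] at h2
  exact ⟨h1, by rw [hF.reverse npr, h1, neg_zero], h2, by rw [hF.reverse npr, h2, neg_zero]⟩

theorem square_bottom_values (hF : PreSystem (bandGraph k) F) (h0 : VanishesOnPaths k F)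
    {p q r s : ZMod (4 * k + 4)} {i : ℕ} (hi : i < k) (vp : p.val = 2 * i)
    (vq : q.val = 2 * i + 2) (vr : r.val = 4 * k - 2 * i) (vs : s.val = 4 * k + 2 - 2 * i) :
    F q r s = 0 ∧ F s r q = 0 ∧ F q p s = 0 ∧ F s p q = 0 := by
  have nqs : ¬(bandGraph k).Adj q s := by
    rw [bandGraph_adj, vq, vs]; unfold BandAdj; omega
  have h1 : F q r s = 0 := by
    rw [eq_natCast_of_val vq, eq_natCast_of_val vr, eq_natCast_of_val vs]
    exact h0.bottom i hi
  have h2 := hF.add_eq_zero (x := q) (z := s) (a := r) (b := p)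
    (by rw [Ne, val_eq_iff]; omega) nqs (by rw [Ne, val_eq_iff]; omega) fun c hc1 hc2 => by
    rw [val_eq_iff, val_eq_iff, vr, vp]
    rw [bandGraph_adj, vq] at hc1
    rw [bandGraph_adj, vs] at hc2
    exact common_neighbor_bottom hi (ZMod.val_lt c) hc1 hc2
  rw [h1, zero_add] at h2
  exact ⟨h1, by rw [hF.reverse nqs, h1, neg_zero], h2, by rw [hF.reverse nqs, h2, neg_zero]⟩

theorem square_eq_zero (hF : PreSystem (bandGraph k) F) (h0 : VanishesOnPaths k F)
    {x y z : ZMod (4 * k + 4)} {i : ℕ} (hi : i < k) (h : SquarePath k i x.val y.val z.val) :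
    F x y z = 0 := by
  have vp := val_natCast_of_lt (k := k) (a := 2 * i) (by omega)
  have vq := val_natCast_of_lt (k := k) (a := 2 * i + 2) (by omega)
  have vr := val_natCast_of_lt (k := k) (a := 4 * k - 2 * i) (by omega)
  have vs := val_natCast_of_lt (k := k) (a := 4 * k + 2 - 2 * i) (by omega)
  rcases h with ⟨h1, h2, h3⟩ | ⟨h1, h2, h3⟩ | ⟨h1, h2, h3⟩ | ⟨h1, h2, h3⟩ | ⟨h1, h2, h3⟩ |
    ⟨h1, h2, h3⟩ | ⟨h1, h2, h3⟩ | ⟨h1, h2, h3⟩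
  · exact (square_top_values hF h0 hi (show x.val = 2 * i by omega)
      (show y.val = 2 * i + 2 by omega) (show z.val = 4 * k - 2 * i by omega)
      vs).1
  · exact (square_top_values hF h0 hi (show z.val = 2 * i by omega)
      (show y.val = 2 * i + 2 by omega) (show x.val = 4 * k - 2 * i by omega)
      vs).2.1
  · exact (square_top_values hF h0 hi (show x.val = 2 * i by omega)
      vq (show z.val = 4 * k - 2 * i by omega)
      (show y.val = 4 * k + 2 - 2 * i by omega)).2.2.1
  · exact (square_top_values hF h0 hi (show z.val = 2 * i by omega)
      vq (show x.val = 4 * k - 2 * i by omega)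
      (show y.val = 4 * k + 2 - 2 * i by omega)).2.2.2
  · exact (square_bottom_values hF h0 hi vp
      (show x.val = 2 * i + 2 by omega) (show y.val = 4 * k - 2 * i by omega)
      (show z.val = 4 * k + 2 - 2 * i by omega)).1
  · exact (square_bottom_values hF h0 hi vp
      (show z.val = 2 * i + 2 by omega) (show y.val = 4 * k - 2 * i by omega)
      (show x.val = 4 * k + 2 - 2 * i by omega)).2.1
  · exact (square_bottom_values hF h0 hi (show y.val = 2 * i by omega)
      (show x.val = 2 * i + 2 by omega) vr
      (show z.val = 4 * k + 2 - 2 * i by omega)).2.2.1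
  · exact (square_bottom_values hF h0 hi (show y.val = 2 * i by omega)
      (show z.val = 2 * i + 2 by omega) vr
      (show x.val = 4 * k + 2 - 2 * i by omega)).2.2.2

theorem SquarePath.reverse {i x y z : ℕ} (h : SquarePath k i x y z) : SquarePath k i z y x := by
  rcases h with h | h | h | h | h | h | h | h
  · exact Or.inr (Or.inl h)
  · exact Or.inl h
  · exact Or.inr (Or.inr (Or.inr (Or.inl h)))
  · exact Or.inr (Or.inr (Or.inl h))
  · exact Or.inr (Or.inr (Or.inr (Or.inr (Or.inr (Or.inl h)))))
  · exact Or.inr (Or.inr (Or.inr (Or.inr (Or.inl h))))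
  · exact Or.inr (Or.inr (Or.inr (Or.inr (Or.inr (Or.inr (Or.inr h))))))
  · exact Or.inr (Or.inr (Or.inr (Or.inr (Or.inr (Or.inr (Or.inl h))))))

theorem square_eq_zero_and_reverse (hF : PreSystem (bandGraph k) F) (h0 : VanishesOnPaths k F)
    {x y z : ZMod (4 * k + 4)} (i : ℕ) (hi : i < k)
    (h : SquarePath k i x.val y.val z.val) : F x y z = 0 ∧ F z y x = 0 :=
  ⟨square_eq_zero hF h0 hi h, square_eq_zero hF h0 hi h.reverse⟩

/-- Either `y` is the only common neighbour of `x` and `z`, or the path lies in square `0` or square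
`k - 1`. -/
theorem straight_eq_zero (hF : PreSystem (bandGraph k) F) (h0 : VanishesOnPaths k F) (hk : 1 < k)
    {x y z : ZMod (4 * k + 4)} (hxy : y = x + 2) (hyz : z = y + 2) :
    F x y z = 0 ∧ F z y x = 0 := by
  rw [eq_add_two_iff] at hxy hyz
  have hx := ZMod.val_lt x
  have hy := ZMod.val_lt y
  have hz := ZMod.val_lt z
  by_cases h : ∃ c, (bandGraph k).Adj x c ∧ (bandGraph k).Adj c z ∧ c ≠ y
  · obtain ⟨c, h1, h2, h3⟩ := h
    rw [Ne, val_eq_iff] at h3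
    have h4 := common_neighbor_four hk hx hy hz (ZMod.val_lt c) hxy hyz h1 h2 h3
    rcases h4 with h4 | h4 | h4 | h4
    · exact square_eq_zero_and_reverse hF h0 0 (by omega)
        (Or.inr (Or.inr (Or.inr (Or.inr (Or.inr (Or.inr (Or.inr ⟨by omega, by omega, by omega⟩)))))))
    · exact square_eq_zero_and_reverse hF h0 0 (by omega)
        (Or.inr (Or.inr (Or.inr (Or.inl ⟨by omega, by omega, by omega⟩))))
    · exact square_eq_zero_and_reverse hF h0 (k - 1) (by omega)
        (Or.inl ⟨by omega, by omega, by omega⟩)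
    · exact square_eq_zero_and_reverse hF h0 (k - 1) (by omega)
        (Or.inr (Or.inr (Or.inr (Or.inr (Or.inl ⟨by omega, by omega, by omega⟩)))))
  · push Not at h
    have hadj : ¬(bandGraph k).Adj x z := by
      rw [bandGraph_adj]; unfold BandAdj; omega
    have := hF.eq_zero_of_unique (by rw [Ne, val_eq_iff]; omega) hadj h
    exact ⟨this, by rw [hF.reverse hadj, this, neg_zero]⟩

/-- A path over an interior chord to an odd vertex is the only path of length two between its ends.
A path that continues to an even vertex lies in one of the two squares at the chord. -/
theorem chord_eq_zero (hF : PreSystem (bandGraph k) F) (h0 : VanishesOnPaths k F) (hk : 1 < k)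
    {x y z : ZMod (4 * k + 4)} (hx2 : x.val % 2 = 0) (hxy : x.val + y.val = 4 * k + 2)
    (hx0 : x.val ≠ 0) (hx0' : x.val ≠ 4 * k + 2) (hxk : x.val ≠ 2 * k) (hxk' : x.val ≠ 2 * k + 2)
    (hyz : z = y + 1 ∨ y = z + 1 ∨ z = y + 2 ∨ y = z + 2) :
    F x y z = 0 ∧ F z y x = 0 := by
  have hx := ZMod.val_lt x
  have hy := ZMod.val_lt y
  have hz := ZMod.val_lt z
  rw [eq_add_one_iff, eq_add_one_iff, eq_add_two_iff, eq_add_two_iff] at hyz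
  by_cases h1 : z.val = y.val + 1 ∨ y.val = z.val + 1
  · have hadj : ¬(bandGraph k).Adj x z := by
      rw [bandGraph_adj]; unfold BandAdj; omega
    have := hF.eq_zero_of_unique (by rw [Ne, val_eq_iff]; omega) hadj (a := y) fun c hc1 hc2 => by
      rw [val_eq_iff]
      exact common_neighbor_chord hk hx hz (ZMod.val_lt c) hx2 hxy hx0 hx0' hxk hxk' h1 hc1 hc2
    exact ⟨this, by rw [hF.reverse hadj, this, neg_zero]⟩
  -- The smaller end of the chord is `2i`, where `i` is the index of the chord, between the squares
  -- `i - 1` and `i`. The direction of the last step selects the square.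
  · by_cases h2 : x.val < 2 * k
    · by_cases h3 : z.val = y.val + 2
      · exact square_eq_zero_and_reverse hF h0 (x.val / 2 - 1) (by omega)
          (Or.inr (Or.inr (Or.inr (Or.inr (Or.inl ⟨by omega, by omega, by omega⟩)))))
      · exact square_eq_zero_and_reverse hF h0 (x.val / 2) (by omega)
          (Or.inr (Or.inr (Or.inl ⟨by omega, by omega, by omega⟩)))
    · by_cases h3 : z.val = y.val + 2
      · exact square_eq_zero_and_reverse hF h0 (y.val / 2) (by omega)
          (Or.inr (Or.inr (Or.inr (Or.inr (Or.inr (Or.inr (Or.inr ⟨by omega, by omega, by omega⟩)))))))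
      · exact square_eq_zero_and_reverse hF h0 (y.val / 2 - 1) (by omega)
          (Or.inr (Or.inl ⟨by omega, by omega, by omega⟩))

/-- The two extreme chords are already edges of the band, so a further edge is an interior chord. -/
theorem bandGraph_adj_cases {x y : ZMod (4 * k + 4)} (h : (bandGraph k).Adj x y) :
    (y = x + 1 ∨ x = y + 1 ∨ y = x + 2 ∨ x = y + 2) ∨
    (x.val % 2 = 0 ∧ x.val + y.val = 4 * k + 2 ∧ x.val ≠ 0 ∧ x.val ≠ 4 * k + 2 ∧
      x.val ≠ 2 * k ∧ x.val ≠ 2 * k + 2) := by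
  have hx := ZMod.val_lt x
  have hy := ZMod.val_lt y
  simp only [eq_add_one_iff, eq_add_two_iff]
  rw [bandGraph_adj] at h
  unfold BandAdj at h
  omega

theorem path_eq_zero (hF : PreSystem (bandGraph k) F) (h0 : VanishesOnPaths k F) (hk : 1 < k)
    {x y z : ZMod (4 * k + 4)} (hxy : (bandGraph k).Adj x y) (hyz : (bandGraph k).Adj y z) :
    F x y z = 0 := by
  by_cases hxz : x = z
  · rw [hxz]; exact hF.ends _ _
  rcases bandGraph_adj_cases hyz with hyz | ⟨h1, h2, h3, h4, h5, h6⟩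
  · rcases bandGraph_adj_cases hxy with hxy | ⟨h1, h2, h3, h4, h5, h6⟩
    · rcases hxy with h1 | h1 | h1 | h1 <;> rcases hyz with h2 | h2 | h2 | h2
      · exact triangle_eq_zero hF h0 x (by grind)
      · exact (hxz (by grind)).elim
      · exact wide_eq_zero hF h0 hk x (by grind)
      · exact triangle_eq_zero hF h0 z (by grind)
      · exact (hxz (by grind)).elim
      · exact triangle_eq_zero hF h0 z (by grind)
      · exact triangle_eq_zero hF h0 y (by grind)
      · exact wide_eq_zero hF h0 hk z (by grind)
      · exact wide_eq_zero hF h0 hk x (by grind)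
      · exact triangle_eq_zero hF h0 x (by grind)
      · exact (straight_eq_zero hF h0 hk h1 h2).1
      · exact (hxz (by grind)).elim
      · exact triangle_eq_zero hF h0 y (by grind)
      · exact wide_eq_zero hF h0 hk z (by grind)
      · exact (hxz (by grind)).elim
      · exact (straight_eq_zero hF h0 hk h2 h1).2
    · exact (chord_eq_zero hF h0 hk h1 h2 h3 h4 h5 h6 hyz).1
  · rcases bandGraph_adj_cases hxy with hxy | ⟨h1', h2', _⟩
    · exact (chord_eq_zero hF h0 hk (x := z) (z := x) (by omega) (by omega) (by omega) (by omega)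
        (by omega) (by omega) (by tauto)).2
    -- A vertex lies on at most one chord, so two chords in succession lead back to the start.
    · exact (hxz (by rw [val_eq_iff]; omega)).elim

/-- A solution of the relations without the symmetry of the row sums vanishes if it vanishes on the
paths `j, j + 1, j + 2` and `j, j + 2, j + 1` and `j, j + 1, j + 3` and on two paths in each
square. -/
theorem PreSystem.eq_zero_of_vanishesOnPaths (hF : PreSystem (bandGraph k) F)
    (h0 : VanishesOnPaths k F) (hk : 1 < k) : F = 0 := by
  funext x y z
  change F x y z = 0
  by_cases hxy : (bandGraph k).Adj x y
  swap
  · exact hF.supp _ _ _ hxy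
  by_cases hyz : (bandGraph k).Adj y z
  · exact path_eq_zero hF h0 hk hxy hyz
  by_cases hxz : (bandGraph k).Adj x z
  · rw [hF.symm]
    exact path_eq_zero hF h0 hk hxy.symm hxz
  -- Now `z` is adjacent to neither end of the edge, and the cyclic relation has a single term.
  have := hF.cyclic x y z
  rwa [hF.supp y z x hyz, hF.supp z x y (fun h => hxz h.symm), add_zero, add_zero] at this

end Vanishing

/-! ### Families with prescribed values on the selected paths -/

section Family

open Classical

variable {k : ℕ} {M : Type*} [AddCommGroup M]

/-- The first corner `2i` of the `i`-th square. -/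
abbrev cornerP (k i : ℕ) : ZMod (4 * k + 4) := ((2 * i : ℕ) : ZMod (4 * k + 4))
/-- The second corner `2i + 2` of the `i`-th square. -/
abbrev cornerQ (k i : ℕ) : ZMod (4 * k + 4) := ((2 * i + 2 : ℕ) : ZMod (4 * k + 4))
/-- The third corner `4k - 2i` of the `i`-th square. -/
abbrev cornerR (k i : ℕ) : ZMod (4 * k + 4) := ((4 * k - 2 * i : ℕ) : ZMod (4 * k + 4))
/-- The fourth corner `4k + 2 - 2i` of the `i`-th square. -/
abbrev cornerS (k i : ℕ) : ZMod (4 * k + 4) := ((4 * k + 2 - 2 * i : ℕ) : ZMod (4 * k + 4))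

theorem sum_ite_eq_and {ι : Type*} [Fintype ι] (a : ι) (P : ι → Prop) (f : ι → M)
    {inst : ∀ j, Decidable (a = j ∧ P j)} {inst' : Decidable (P a)} :
    ∑ j, @ite _ (a = j ∧ P j) (inst j) (f j) 0 = @ite _ (P a) inst' (f a) 0 := by
  rw [Finset.sum_eq_single a]
  · simp
  · intro j _ hj
    rw [if_neg (fun h => hj h.1.symm)]
  · simp

/-- The sum of the families supported on the paths `j, j + b, j + c`, with values `f j`. -/
def bandPath (b c : ZMod (4 * k + 4)) (f : ZMod (4 * k + 4) → M) :
    ZMod (4 * k + 4) → ZMod (4 * k + 4) → ZMod (4 * k + 4) → M :=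
  ∑ j, pathFn j (j + b) (j + c) (f j)

theorem bandPath_apply (b c : ZMod (4 * k + 4)) (f : ZMod (4 * k + 4) → M)
    (x y z : ZMod (4 * k + 4)) : bandPath b c f x y z =
    (if y = x + b ∧ z = x + c then f x else 0) + (if x = y + b ∧ z = y + c then f y else 0) -
    (if y = z + b ∧ x = z + c then f z else 0) - (if x = z + b ∧ y = z + c then f z else 0) := by
  simp only [bandPath, Finset.sum_apply, pathFn_apply, Finset.sum_add_distrib,
    Finset.sum_sub_distrib]
  refine congrArg₂ (· - ·) (congrArg₂ (· - ·) (congrArg₂ (· + ·) ?_ ?_) ?_) ?_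
  · exact sum_ite_eq_and x (fun j => y = j + b ∧ z = j + c) f
  · exact sum_ite_eq_and y (fun j => x = j + b ∧ z = j + c) f
  · exact sum_ite_eq_and z (fun j => y = j + b ∧ x = j + c) f
  · exact sum_ite_eq_and z (fun j => x = j + b ∧ y = j + c) f

/-- The part of a family on the squares of the strip. -/
def stripPart (k : ℕ) (α β : ℕ → M) :
    ZMod (4 * k + 4) → ZMod (4 * k + 4) → ZMod (4 * k + 4) → M :=
  ∑ i ∈ Finset.range k, (cycleFn (cornerP k i) (cornerQ k i) (cornerR k i) (cornerS k i) (α i) +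
    cycleFn (cornerQ k i) (cornerR k i) (cornerS k i) (cornerP k i) (β i))

/-- The family with given values on the paths that determine a family. -/
def family (C B D : ZMod (4 * k + 4) → M) (α β : ℕ → M) :
    ZMod (4 * k + 4) → ZMod (4 * k + 4) → ZMod (4 * k + 4) → M :=
  bandPath 1 2 C + bandPath 2 1 B + (bandPath 1 3 D - bandPath 2 3 D) + stripPart k α β

theorem bandGraph_adj_of_eq_add {x y : ZMod (4 * k + 4)} (h : y = x + 1 ∨ y = x + 2) :
    (bandGraph k).Adj x y := by
  rw [eq_add_one_iff, eq_add_two_iff] at h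
  have hx := ZMod.val_lt x
  have hy := ZMod.val_lt y
  rw [bandGraph_adj]
  unfold BandAdj
  omega

/-- The terms of `C` and `B` live on triangles of the band, those of `D` on the four-cycles `j, j +
1, j + 3, j + 2`, and those of `α` and `β` on the squares of the strip. -/
theorem preSystem_family (C B D : ZMod (4 * k + 4) → M) (α β : ℕ → M) :
    PreSystem (bandGraph k) (family C B D α β) := by
  rw [← mem_preSystems, family]
  have h1 : ∀ j : ZMod (4 * k + 4), (bandGraph k).Adj j (j + 1) := fun j =>
    bandGraph_adj_of_eq_add (Or.inl rfl)
  have h2 : ∀ j : ZMod (4 * k + 4), (bandGraph k).Adj j (j + 2) := fun j =>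
    bandGraph_adj_of_eq_add (Or.inr rfl)
  have h12 : ∀ j : ZMod (4 * k + 4), (bandGraph k).Adj (j + 1) (j + 2) := fun j =>
    bandGraph_adj_of_eq_add (Or.inl (by ring))
  have h13 : ∀ j : ZMod (4 * k + 4), (bandGraph k).Adj (j + 1) (j + 3) := fun j =>
    bandGraph_adj_of_eq_add (Or.inr (by ring))
  have h23 : ∀ j : ZMod (4 * k + 4), (bandGraph k).Adj (j + 2) (j + 3) := fun j =>
    bandGraph_adj_of_eq_add (Or.inl (by ring))
  have h3 : ∀ j : ZMod (4 * k + 4), j ≠ j + 3 := fun j => by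
    have hj := ZMod.val_lt j
    have hv := eq_add_three_iff.1 (rfl : j + 3 = j + 3)
    rw [Ne, val_eq_iff]
    omega
  refine add_mem (add_mem (add_mem ?_ ?_) ?_) ?_
  · exact sum_mem fun j _ => preSystem_pathFn (h1 j) (h12 j) (h2 j) _
  · exact sum_mem fun j _ => preSystem_pathFn (h2 j) (h12 j).symm (h1 j) _
  · have : bandPath 1 3 D - bandPath 2 3 D =
        ∑ j, cycleFn j (j + 1) (j + 3) (j + 2) (D j) := by
      simp only [bandPath, cycleFn_apply, Finset.sum_sub_distrib]
    rw [this]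
    exact sum_mem fun j _ => preSystem_cycleFn (h1 j) (h13 j) (h23 j).symm (h2 j).symm (h3 j) _
  · refine sum_mem fun i hi => ?_
    have hi := Finset.mem_range.1 hi
    have vp := val_natCast_of_lt (k := k) (a := 2 * i) (by omega)
    have vq := val_natCast_of_lt (k := k) (a := 2 * i + 2) (by omega)
    have vr := val_natCast_of_lt (k := k) (a := 4 * k - 2 * i) (by omega)
    have vs := val_natCast_of_lt (k := k) (a := 4 * k + 2 - 2 * i) (by omega)
    have hpq : (bandGraph k).Adj (cornerP k i) (cornerQ k i) := by
      rw [bandGraph_adj, vp, vq]; unfold BandAdj; omega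
    have hqr : (bandGraph k).Adj (cornerQ k i) (cornerR k i) := by
      rw [bandGraph_adj, vq, vr]; unfold BandAdj; omega
    have hrs : (bandGraph k).Adj (cornerR k i) (cornerS k i) := by
      rw [bandGraph_adj, vr, vs]; unfold BandAdj; omega
    have hsp : (bandGraph k).Adj (cornerS k i) (cornerP k i) := by
      rw [bandGraph_adj, vs, vp]; unfold BandAdj; omega
    refine add_mem (preSystem_cycleFn hpq hqr hrs hsp ?_ _)
      (preSystem_cycleFn hqr hrs hsp hpq ?_ _)
    · rw [Ne, val_eq_iff, vp, vr]; omega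
    · rw [Ne, val_eq_iff, vq, vs]; omega

theorem cycleFn_eq_zero {p q r s x y z : ZMod (4 * k + 4)} (m : M) (t : ZMod (4 * k + 4))
    (ht : t = x ∨ t = y ∨ t = z) (hp : t ≠ p) (hq : t ≠ q) (hr : t ≠ r) (hs : t ≠ s) :
    cycleFn p q r s m x y z = 0 := by
  simp only [cycleFn_apply, Pi.sub_apply, pathFn_apply]
  rcases ht with rfl | rfl | rfl <;> simp [hp, hq, hr, hs]

theorem stripPart_eq_zero {x y z : ZMod (4 * k + 4)} (α β : ℕ → M)
    (h : x.val % 2 = 1 ∨ y.val % 2 = 1 ∨ z.val % 2 = 1) : stripPart k α β x y z = 0 := by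
  obtain ⟨t, ht, ht1⟩ : ∃ t, (t = x ∨ t = y ∨ t = z) ∧ t.val % 2 = 1 := by
    rcases h with h | h | h
    · exact ⟨x, by simp, h⟩
    · exact ⟨y, by simp, h⟩
    · exact ⟨z, by simp, h⟩
  simp only [stripPart, Finset.sum_apply, Pi.add_apply]
  refine Finset.sum_eq_zero fun i hi => ?_
  have hi := Finset.mem_range.1 hi
  have vp := val_natCast_of_lt (k := k) (a := 2 * i) (by omega)
  have vq := val_natCast_of_lt (k := k) (a := 2 * i + 2) (by omega)
  have vr := val_natCast_of_lt (k := k) (a := 4 * k - 2 * i) (by omega)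
  have vs := val_natCast_of_lt (k := k) (a := 4 * k + 2 - 2 * i) (by omega)
  have hp : t ≠ cornerP k i := by rw [Ne, val_eq_iff, vp]; omega
  have hq : t ≠ cornerQ k i := by rw [Ne, val_eq_iff, vq]; omega
  have hr : t ≠ cornerR k i := by rw [Ne, val_eq_iff, vr]; omega
  have hs : t ≠ cornerS k i := by rw [Ne, val_eq_iff, vs]; omega
  rw [cycleFn_eq_zero _ t ht hp hq hr hs, cycleFn_eq_zero _ t ht hq hr hs hp, add_zero]

/-- One of the offsets `b`, `c` is odd and `4k + 4` is even, so each of these paths contains an odd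
vertex. The strip has only even ones, which separates the two parts of a family. -/
theorem bandPath_eq_zero {x y z : ZMod (4 * k + 4)} {b c : ZMod (4 * k + 4)}
    (h : (b = 1 ∧ c = 2) ∨ (b = 2 ∧ c = 1) ∨ (b = 1 ∧ c = 3) ∨ (b = 2 ∧ c = 3))
    (f : ZMod (4 * k + 4) → M) (hx : x.val % 2 = 0) (hy : y.val % 2 = 0) (hz : z.val % 2 = 0) :
    bandPath b c f x y z = 0 := by
  rw [bandPath_apply]
  rcases h with ⟨rfl, rfl⟩ | ⟨rfl, rfl⟩ | ⟨rfl, rfl⟩ | ⟨rfl, rfl⟩ <;>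
  · simp only [eq_add_one_iff, eq_add_two_iff, eq_add_three_iff]
    rw [if_neg (by omega), if_neg (by omega), if_neg (by omega), if_neg (by omega)]
    simp

theorem family_eq_stripPart {C B D : ZMod (4 * k + 4) → M} {α β : ℕ → M}
    {x y z : ZMod (4 * k + 4)} (hx : x.val % 2 = 0) (hy : y.val % 2 = 0) (hz : z.val % 2 = 0) :
    family C B D α β x y z = stripPart k α β x y z := by
  simp only [family, Pi.add_apply, Pi.sub_apply]
  rw [bandPath_eq_zero (by simp) _ hx hy hz, bandPath_eq_zero (by simp) _ hx hy hz,
    bandPath_eq_zero (by simp) _ hx hy hz, bandPath_eq_zero (by simp) _ hx hy hz]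
  simp

theorem family_top {C B D : ZMod (4 * k + 4) → M} {α β : ℕ → M} {i : ℕ} (hi : i < k) :
    family C B D α β (cornerP k i) (cornerQ k i) (cornerR k i) = α i := by
  have v : ∀ a, a < 4 * k + 4 → ((a : ℕ) : ZMod (4 * k + 4)).val = a := fun a ha =>
    val_natCast_of_lt ha
  rw [family_eq_stripPart (by rw [v _ (by omega)]; omega) (by rw [v _ (by omega)]; omega)
    (by rw [v _ (by omega)]; omega)]
  simp only [stripPart, Finset.sum_apply, Pi.add_apply]
  rw [Finset.sum_eq_single i]
  · simp only [cycleFn_apply, Pi.sub_apply, pathFn_apply, val_eq_iff]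
    rw [v _ (show 2 * i < _ by omega), v _ (show 2 * i + 2 < _ by omega),
      v _ (show 4 * k - 2 * i < _ by omega), v _ (show 4 * k + 2 - 2 * i < _ by omega)]
    rw [if_pos (show True ∧ True ∧ True by simp)]
    repeat rw [if_neg (by omega)]
    simp
  · intro j hj hji
    have hj := Finset.mem_range.1 hj
    simp only [cycleFn_apply, Pi.sub_apply, pathFn_apply, val_eq_iff]
    rw [v _ (show 2 * i < _ by omega), v _ (show 2 * i + 2 < _ by omega),
      v _ (show 4 * k - 2 * i < _ by omega),
      v _ (show 2 * j < _ by omega), v _ (show 2 * j + 2 < _ by omega),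
      v _ (show 4 * k - 2 * j < _ by omega), v _ (show 4 * k + 2 - 2 * j < _ by omega)]
    repeat rw [if_neg (by omega)]
    simp
  · exact fun h => (h (Finset.mem_range.2 hi)).elim

theorem family_bottom {C B D : ZMod (4 * k + 4) → M} {α β : ℕ → M} {i : ℕ} (hi : i < k) :
    family C B D α β (cornerQ k i) (cornerR k i) (cornerS k i) = β i := by
  have v : ∀ a, a < 4 * k + 4 → ((a : ℕ) : ZMod (4 * k + 4)).val = a := fun a ha =>
    val_natCast_of_lt ha
  rw [family_eq_stripPart (by rw [v _ (by omega)]; omega) (by rw [v _ (by omega)]; omega)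
    (by rw [v _ (by omega)]; omega)]
  simp only [stripPart, Finset.sum_apply, Pi.add_apply]
  rw [Finset.sum_eq_single i]
  · simp only [cycleFn_apply, Pi.sub_apply, pathFn_apply, val_eq_iff]
    rw [v _ (show 2 * i < _ by omega), v _ (show 2 * i + 2 < _ by omega),
      v _ (show 4 * k - 2 * i < _ by omega), v _ (show 4 * k + 2 - 2 * i < _ by omega)]
    rw [if_pos (show True ∧ True ∧ True by simp)]
    repeat rw [if_neg (by omega)]
    simp
  · intro j hj hji
    have hj := Finset.mem_range.1 hj
    simp only [cycleFn_apply, Pi.sub_apply, pathFn_apply, val_eq_iff]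
    rw [v _ (show 4 * k + 2 - 2 * i < _ by omega), v _ (show 2 * i + 2 < _ by omega),
      v _ (show 4 * k - 2 * i < _ by omega),
      v _ (show 2 * j < _ by omega), v _ (show 2 * j + 2 < _ by omega),
      v _ (show 4 * k - 2 * j < _ by omega), v _ (show 4 * k + 2 - 2 * j < _ by omega)]
    repeat rw [if_neg (by omega)]
    simp
  · exact fun h => (h (Finset.mem_range.2 hi)).elim

theorem natCast_ne_zero {c : ℕ} (h0 : c ≠ 0) (h : c < 4 * k + 4) : (c : ZMod (4 * k + 4)) ≠ 0 := by
  rw [Ne, val_eq_iff, val_natCast_of_lt h, ZMod.val_zero]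
  exact h0

theorem bandPath_apply_add (b c d e j : ZMod (4 * k + 4)) (f : ZMod (4 * k + 4) → M)
    (h1 : d + b ≠ 0) (h2 : e + c ≠ 0) (h3 : e + b ≠ 0) :
    bandPath b c f j (j + d) (j + e) = if d = b ∧ e = c then f j else 0 := by
  rw [bandPath_apply, if_neg (show ¬(j = j + d + b ∧ j + e = j + d + c) by
      rintro ⟨h, -⟩; exact h1 (by linear_combination -h)),
    if_neg (show ¬(j + d = j + e + b ∧ j = j + e + c) by
      rintro ⟨-, h⟩; exact h2 (by linear_combination -h)),
    if_neg (show ¬(j = j + e + b ∧ j + d = j + e + c) by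
      rintro ⟨h, -⟩; exact h3 (by linear_combination -h))]
  simp

theorem exists_odd (j : ZMod (4 * k + 4)) : j.val % 2 = 1 ∨ (j + 1).val % 2 = 1 := by
  have hj := ZMod.val_lt j
  have hj' := ZMod.val_lt (j + 1)
  have := eq_add_one_iff.1 (rfl : j + 1 = j + 1)
  omega

theorem family_band {C B D : ZMod (4 * k + 4) → M} {α β : ℕ → M} (hk : 1 < k)
    (j : ZMod (4 * k + 4)) :
    family C B D α β j (j + 1) (j + 2) = C j ∧ family C B D α β j (j + 2) (j + 1) = B j ∧
    family C B D α β j (j + 1) (j + 3) = D j := by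
  -- There are at least twelve vertices, so sums of two offsets, which are at most 6, do not wrap
  -- round to zero.
  have n : ∀ c : ℕ, c ≠ 0 → c < 12 → (c : ZMod (4 * k + 4)) ≠ 0 := fun c h0 h =>
    natCast_ne_zero h0 (by omega)
  have n1 : (1 : ZMod (4 * k + 4)) ≠ 0 := by exact_mod_cast n 1 (by omega) (by omega)
  have n2 : (2 : ZMod (4 * k + 4)) ≠ 0 := by exact_mod_cast n 2 (by omega) (by omega)
  have n3 : (3 : ZMod (4 * k + 4)) ≠ 0 := by exact_mod_cast n 3 (by omega) (by omega)
  have n4 : (4 : ZMod (4 * k + 4)) ≠ 0 := by exact_mod_cast n 4 (by omega) (by omega)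
  have n5 : (5 : ZMod (4 * k + 4)) ≠ 0 := by exact_mod_cast n 5 (by omega) (by omega)
  have n6 : (6 : ZMod (4 * k + 4)) ≠ 0 := by exact_mod_cast n 6 (by omega) (by omega)
  have h12 : (1 : ZMod (4 * k + 4)) ≠ 2 := fun h => n1 (by linear_combination -h)
  have h13 : (1 : ZMod (4 * k + 4)) ≠ 3 := fun h => n2 (by linear_combination -h)
  have h23 : (2 : ZMod (4 * k + 4)) ≠ 3 := fun h => n1 (by linear_combination -h)
  have hs := exists_odd j
  refine ⟨?_, ?_, ?_⟩
  all_goals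
    simp only [family, Pi.add_apply, Pi.sub_apply]
    rw [stripPart_eq_zero α β (by tauto), bandPath_apply_add, bandPath_apply_add,
      bandPath_apply_add, bandPath_apply_add]
    · simp [h12, h13, h23, h12.symm, h13.symm, h23.symm]
    all_goals
      norm_num
      assumption

end Family

/-! ### Symmetry of the row sums as equations for the prescribed values -/

section Asym

open Classical

variable {k : ℕ} {M : Type*} [AddCommGroup M]

/-- The sum of the antisymmetric functions supported on the pairs `j, j + b`, with values `f j`. -/
def bandDart (b : ZMod (4 * k + 4)) :
    (ZMod (4 * k + 4) → M) →+ (ZMod (4 * k + 4) → ZMod (4 * k + 4) → M) :=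
  ∑ j, (dart j (j + b)).comp (Pi.evalAddMonoidHom _ j)

theorem bandDart_eq_sum (b : ZMod (4 * k + 4)) (f : ZMod (4 * k + 4) → M) :
    bandDart b f = ∑ j, dart j (j + b) (f j) := by
  simp [bandDart]

theorem bandDart_shift (b c : ZMod (4 * k + 4)) (f : ZMod (4 * k + 4) → M) :
    ∑ j, dart (j + c) (j + c + b) (f j) = bandDart b fun j => f (j - c) := by
  rw [bandDart_eq_sum]
  refine Fintype.sum_equiv (Equiv.addRight c) _ _ fun j => ?_
  simp

theorem bandDart_apply (b : ZMod (4 * k + 4)) (f : ZMod (4 * k + 4) → M) (x z : ZMod (4 * k + 4)) :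
    bandDart b f x z = (if z = x + b then f x else 0) - (if x = z + b then f z else 0) := by
  simp only [bandDart_eq_sum, Finset.sum_apply, dart_apply, Finset.sum_sub_distrib]
  refine congrArg₂ (· - ·) (sum_ite_eq_and x (fun j => z = j + b) f) ?_
  rw [← sum_ite_eq_and z (fun j => x = j + b) f (inst := fun j => Classical.dec _)]
  refine Finset.sum_congr rfl fun j _ => ?_
  by_cases h : x = j + b ∧ z = j
  · rw [if_pos h, if_pos h.symm]
  · rw [if_neg h, if_neg fun h' => h h'.symm]

/-- The antisymmetric function on the boundary of the `i`-th square. -/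
def squareDart (k i : ℕ) (m : M) : ZMod (4 * k + 4) → ZMod (4 * k + 4) → M :=
  dart (cornerP k i) (cornerQ k i) m + dart (cornerQ k i) (cornerR k i) m +
    dart (cornerR k i) (cornerS k i) m + dart (cornerS k i) (cornerP k i) m

theorem asym_bandPath_one (C : ZMod (4 * k + 4) → M) : asym (bandPath 1 2 C) =
    bandDart 1 (fun j => C (j - 1) + C j) + bandDart 2 (fun j => 2 • C j) := by
  have h1 := bandDart_shift 1 1 C
  have e : ∀ j : ZMod (4 * k + 4), j + 1 + 1 = j + 2 := fun j => by ring
  simp only [e] at h1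
  have : (fun j => C (j - 1) + C j) = (fun j => C (j - 1)) + C := rfl
  rw [this, map_add, ← h1, show (fun j => 2 • C j) = 2 • C from rfl, map_nsmul,
    bandDart_eq_sum, bandDart_eq_sum]
  simp only [bandPath, map_sum, asym_pathFn, Finset.sum_add_distrib, Finset.smul_sum]
  abel

theorem asym_bandPath_two (B : ZMod (4 * k + 4) → M) : asym (bandPath 2 1 B) =
    bandDart 1 (fun j => 2 • B j - B (j - 1)) + bandDart 2 B := by
  have h1 := bandDart_shift 1 1 B
  have e : ∀ j : ZMod (4 * k + 4), j + 1 + 1 = j + 2 := fun j => by ring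
  simp only [e] at h1
  have : (fun j => 2 • B j - B (j - 1)) = 2 • B - (fun j => B (j - 1)) := rfl
  rw [this, map_sub, ← h1, map_nsmul, bandDart_eq_sum, bandDart_eq_sum]
  simp only [bandPath, map_sum, asym_pathFn, Finset.sum_add_distrib, Finset.smul_sum,
    fun j : ZMod (4 * k + 4) => dart_swap (j + 1) (j + 2) (B j), Finset.sum_neg_distrib]
  abel

theorem asym_bandPath_three (D : ZMod (4 * k + 4) → M) :
    asym (bandPath 1 3 D - bandPath 2 3 D) =
    bandDart 1 (fun j => D j - D (j - 2)) + bandDart 2 (fun j => D (j - 1) - D j) := by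
  have h1 := bandDart_shift 1 2 D
  have h2 := bandDart_shift 2 1 D
  have e : ∀ j : ZMod (4 * k + 4), j + 2 + 1 = j + 3 := fun j => by ring
  have e' : ∀ j : ZMod (4 * k + 4), j + 1 + 2 = j + 3 := fun j => by ring
  simp only [e] at h1
  simp only [e'] at h2
  have : bandPath 1 3 D - bandPath 2 3 D =
      ∑ j, cycleFn j (j + 1) (j + 3) (j + 2) (D j) := by
    simp only [bandPath, cycleFn_apply, Finset.sum_sub_distrib]
  rw [this, show (fun j => D j - D (j - 2)) = D - fun j => D (j - 2) from rfl,
    show (fun j => D (j - 1) - D j) = (fun j => D (j - 1)) - D from rfl, map_sub, map_sub,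
    ← h1, ← h2, bandDart_eq_sum, bandDart_eq_sum]
  simp only [map_sum, asym_cycleFn, Finset.sum_add_distrib,
    fun j : ZMod (4 * k + 4) => dart_swap (j + 2) (j + 3) (D j),
    fun j : ZMod (4 * k + 4) => dart_swap j (j + 2) (D j), Finset.sum_neg_distrib]
  abel

/-- The two families of a square start at consecutive corners and have the same oriented boundary,
so only `α i + β i` enters. -/
theorem asym_stripPart (α β : ℕ → M) :
    asym (stripPart k α β) = ∑ i ∈ Finset.range k, squareDart k i (α i + β i) := by
  simp only [stripPart, map_sum, map_add, asym_cycleFn, squareDart]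
  refine Finset.sum_congr rfl fun i _ => ?_
  abel

/-- The defect of symmetry of a family at the pair `j, j + 1`. -/
def nearDefect (C B D : ZMod (4 * k + 4) → M) (j : ZMod (4 * k + 4)) : M :=
  C (j - 1) + C j + (2 • B j - B (j - 1)) + (D j - D (j - 2))

/-- The defect of symmetry of the band part of a family at the pair `j, j + 2`. -/
def wideDefect (C B D : ZMod (4 * k + 4) → M) (j : ZMod (4 * k + 4)) : M :=
  2 • C j + B j + (D (j - 1) - D j)

theorem asym_family (C B D : ZMod (4 * k + 4) → M) (α β : ℕ → M) :
    asym (family C B D α β) = bandDart 1 (nearDefect C B D) + bandDart 2 (wideDefect C B D) +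
      ∑ i ∈ Finset.range k, squareDart k i (α i + β i) := by
  have h1 : nearDefect C B D = (fun j => C (j - 1) + C j) + (fun j => 2 • B j - B (j - 1)) +
    (fun j => D j - D (j - 2)) := rfl
  have h2 : wideDefect C B D = (fun j => 2 • C j) + B + (fun j => D (j - 1) - D j) := rfl
  rw [family, map_add, map_add, map_add, asym_bandPath_one, asym_bandPath_two,
    asym_bandPath_three, asym_stripPart, h1, h2]
  simp only [map_add]
  abel

theorem sum_even (g : ℕ → M) :
    ∑ j : ZMod (4 * k + 4), (if j.val % 2 = 0 then g j.val else 0) =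
      ∑ t ∈ Finset.range (2 * k + 2), g (2 * t) := by
  rw [← Finset.sum_filter]
  refine Finset.sum_nbij' (fun j => j.val / 2) (fun t => ((2 * t : ℕ) : ZMod (4 * k + 4)))
    ?_ ?_ ?_ ?_ ?_
  · intro j hj
    have := ZMod.val_lt j
    simp only [Finset.mem_filter, Finset.mem_univ, true_and, Finset.mem_range] at hj ⊢
    omega
  · intro t ht
    simp only [Finset.mem_filter, Finset.mem_univ, true_and, Finset.mem_range] at ht ⊢
    rw [val_natCast_of_lt (by omega)]
    omega
  · intro j hj
    have := ZMod.val_lt j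
    simp only [Finset.mem_filter, Finset.mem_univ, true_and] at hj ⊢
    rw [val_eq_iff, val_natCast_of_lt (by omega)]
    omega
  · intro t ht
    simp only [Finset.mem_range] at ht ⊢
    rw [val_natCast_of_lt (by omega)]
    omega
  · intro j hj
    simp only [Finset.mem_filter, Finset.mem_univ, true_and] at hj ⊢
    rw [show 2 * (j.val / 2) = j.val by omega]

/-- A discrete Green's theorem: neighbouring squares traverse their common chord in opposite
directions, and the boundary cycle of the strip remains, which joins consecutive even vertices. -/
theorem sum_squareDart (γ : M) : ∑ i ∈ Finset.range k, squareDart k i γ =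
    bandDart 2 (fun j => if j.val % 2 = 0 then γ else 0) := by
  let d : ℕ → ZMod (4 * k + 4) → ZMod (4 * k + 4) → M := fun n =>
    dart (n : ZMod (4 * k + 4)) ((n + 2 : ℕ) : ZMod (4 * k + 4)) γ
  let c : ℕ → ZMod (4 * k + 4) → ZMod (4 * k + 4) → M := fun i =>
    dart (cornerP k i) (cornerS k i) γ
  have hr : bandDart 2 (fun j : ZMod (4 * k + 4) => if j.val % 2 = 0 then γ else 0) =
      ∑ t ∈ Finset.range (2 * k + 2), d (2 * t) := by
    rw [bandDart_eq_sum, ← sum_even d]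
    refine Finset.sum_congr rfl fun j _ => ?_
    split_ifs
    · simp [d]
    · simp
  -- A square contributes its two boundary edges `2i, 2i + 2` and `4k - 2i, 4k + 2 - 2i` and a
  -- telescoping difference of chords.
  have hs : ∀ i ∈ Finset.range k, squareDart k i γ =
      d (2 * i) + d (2 * (2 * k - i)) + (c (i + 1) - c i) := by
    intro i hi
    have hi := Finset.mem_range.1 hi
    simp only [squareDart, d, c, cornerP, cornerQ, cornerR, cornerS]
    rw [show 2 * (2 * k - i) = 4 * k - 2 * i by omega,
      show 4 * k - 2 * i + 2 = 4 * k + 2 - 2 * i by omega,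
      show 4 * k + 2 - 2 * (i + 1) = 4 * k - 2 * i by omega,
      show 2 * (i + 1) = 2 * i + 2 by ring,
      dart_swap ((2 * i : ℕ) : ZMod (4 * k + 4))]
    abel
  -- The extreme chords left by the telescoping are the two missing edges of the boundary cycle; the
  -- second one passes through `4k + 4 = 0`.
  have hc : c k = d (2 * k) := by
    simp only [c, d, cornerP, cornerS]
    rw [show 4 * k + 2 - 2 * k = 2 * k + 2 by omega]
  have hc0 : c 0 = -d (2 * (2 * k + 1)) := by
    simp only [c, d, cornerP, cornerS]
    rw [← dart_swap, show 2 * (2 * k + 1) + 2 = 4 * k + 4 by ring, ZMod.natCast_self,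
      show 2 * (2 * k + 1) = 4 * k + 2 - 2 * 0 by omega]
    simp
  rw [hr, Finset.sum_congr rfl hs, Finset.sum_add_distrib, Finset.sum_add_distrib,
    Finset.sum_range_sub, hc, hc0, Finset.sum_range_succ, show 2 * k + 1 = (k + 1) + k by ring,
    Finset.sum_range_add, Finset.sum_range_succ,
    ← Finset.sum_range_reflect (fun i => d (2 * (k + 1 + i)))]
  have : ∑ i ∈ Finset.range k, d (2 * (2 * k - i)) =
      ∑ i ∈ Finset.range k, d (2 * (k + 1 + (k - 1 - i))) :=
    Finset.sum_congr rfl fun i hi => by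
      have hi := Finset.mem_range.1 hi
      rw [show 2 * k - i = k + 1 + (k - 1 - i) by omega]
  rw [this]
  abel

theorem squareDart_apply_chord {i i' : ℕ} (hi : 0 < i) (hik : i < k) (hi' : i' < k) (m : M) :
    squareDart k i' m (cornerP k i) (cornerS k i) =
      (if i' = i - 1 then m else 0) - (if i' = i then m else 0) := by
  have v : ∀ a, a < 4 * k + 4 → ((a : ℕ) : ZMod (4 * k + 4)).val = a := fun a ha =>
    val_natCast_of_lt ha
  simp only [squareDart, Pi.add_apply, dart_apply, val_eq_iff]
  rw [v _ (show 2 * i < _ by omega), v _ (show 4 * k + 2 - 2 * i < _ by omega),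
    v _ (show 4 * k + 2 - 2 * i' < _ by omega), v _ (show 2 * i' < _ by omega),
    v _ (show 2 * i' + 2 < _ by omega), v _ (show 4 * k - 2 * i' < _ by omega)]
  by_cases h1 : i' = i
  · subst h1
    rw [if_pos (show 2 * i' = 2 * i' ∧ 4 * k + 2 - 2 * i' = 4 * k + 2 - 2 * i' by omega)]
    repeat rw [if_neg (by omega)]
    simp
  · by_cases h2 : i' = i - 1
    · rw [if_pos (show 2 * i = 2 * i' + 2 ∧ 4 * k + 2 - 2 * i = 4 * k - 2 * i' by omega),
        if_pos h2]
      repeat rw [if_neg (by omega)]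
      simp
    · repeat rw [if_neg (by omega)]
      simp

theorem sum_squareDart_apply_chord {i : ℕ} (hi : 0 < i) (hik : i < k) (γ : ℕ → M) :
    (∑ i' ∈ Finset.range k, squareDart k i' (γ i')) (cornerP k i) (cornerS k i) =
      γ (i - 1) - γ i := by
  rw [Finset.sum_apply, Finset.sum_apply, Finset.sum_congr rfl fun i' hi' =>
    squareDart_apply_chord hi hik (Finset.mem_range.1 hi') (γ i'), Finset.sum_sub_distrib,
    Finset.sum_ite_eq', Finset.sum_ite_eq', if_pos (Finset.mem_range.2 (by omega)),
    if_pos (Finset.mem_range.2 hik)]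

theorem bandDart_apply_chord {i : ℕ} (hi : 0 < i) (hik : i < k) {b : ZMod (4 * k + 4)}
    (hb : b = 1 ∨ b = 2) (f : ZMod (4 * k + 4) → M) :
    bandDart b f (cornerP k i) (cornerS k i) = 0 := by
  have v1 := val_natCast_of_lt (k := k) (a := 2 * i) (by omega)
  have v2 := val_natCast_of_lt (k := k) (a := 4 * k + 2 - 2 * i) (by omega)
  rw [bandDart_apply]
  rcases hb with rfl | rfl
  · simp only [eq_add_one_iff, v1, v2]
    rw [if_neg (by omega), if_neg (by omega), sub_zero]
  · simp only [eq_add_two_iff, v1, v2]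
    rw [if_neg (by omega), if_neg (by omega), sub_zero]

theorem bandDart_eq_zero_iff (hk : 1 < k) (f g : ZMod (4 * k + 4) → M) :
    bandDart 1 f + bandDart 2 g = 0 ↔ f = 0 ∧ g = 0 := by
  refine ⟨fun h => ⟨?_, ?_⟩, fun h => by rw [h.1, h.2, map_zero, map_zero, add_zero]⟩
  all_goals
    funext j
    have hj := ZMod.val_lt j
    have e1 := eq_add_one_iff.1 (rfl : j + 1 = j + 1)
    have e2 := eq_add_two_iff.1 (rfl : j + 2 = j + 2)
  · have := congrFun (congrFun h j) (j + 1)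
    simp only [Pi.add_apply, bandDart_apply] at this
    rw [if_pos trivial, if_neg (show ¬j = j + 1 + 1 by rw [eq_add_one_iff]; omega),
      if_neg (show ¬j + 1 = j + 2 by rw [eq_add_two_iff]; omega),
      if_neg (show ¬j = j + 1 + 2 by rw [eq_add_two_iff]; omega)] at this
    simpa using this
  · have := congrFun (congrFun h j) (j + 2)
    simp only [Pi.add_apply, bandDart_apply] at this
    rw [if_pos trivial, if_neg (show ¬j + 2 = j + 1 by rw [eq_add_one_iff]; omega),
      if_neg (show ¬j = j + 2 + 1 by rw [eq_add_one_iff]; omega),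
      if_neg (show ¬j = j + 2 + 2 by rw [eq_add_two_iff]; omega)] at this
    simpa using this

/-- The band terms vanish at interior chords, so symmetry there forces the sums `α i + β i` to
agree. The strip then contributes only at even pairs `j, j + 2`, and the pairs at distance one and
two can be read off separately. -/
theorem system_family_iff (hk : 1 < k) {C B D : ZMod (4 * k + 4) → M} {α β : ℕ → M} :
    System (bandGraph k) (family C B D α β) ↔ (∀ i < k, α i + β i = α 0 + β 0) ∧
      (∀ j, nearDefect C B D j = 0) ∧
      (∀ j, wideDefect C B D j + (if j.val % 2 = 0 then α 0 + β 0 else 0) = 0) := by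
  have key : (∀ i < k, α i + β i = α 0 + β 0) → asym (family C B D α β) =
      bandDart 1 (nearDefect C B D) + bandDart 2 (wideDefect C B D +
        fun j => if j.val % 2 = 0 then α 0 + β 0 else 0) := by
    intro h
    rw [asym_family, map_add, ← sum_squareDart, ← add_assoc]
    congr 1
    exact Finset.sum_congr rfl fun i hi => by rw [h i (Finset.mem_range.1 hi)]
  constructor
  · intro hF
    have h0 := hF.asym_eq_zero
    have hγ : ∀ i < k, α i + β i = α 0 + β 0 := by
      intro i hi
      induction i with
      | zero => rfl
      | succ i ih =>
        rw [← ih (by omega)]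
        have := congrFun (congrFun h0 (cornerP k (i + 1))) (cornerS k (i + 1))
        rw [asym_family, Pi.add_apply, Pi.add_apply, Pi.add_apply, Pi.add_apply,
          bandDart_apply_chord (by omega) hi (Or.inl rfl),
          bandDart_apply_chord (by omega) hi (Or.inr rfl),
          sum_squareDart_apply_chord (by omega) hi (fun i => α i + β i)] at this
        refine Eq.symm ?_
        simpa [sub_eq_zero] using this
    rw [key hγ, bandDart_eq_zero_iff hk] at h0
    exact ⟨hγ, congrFun h0.1, congrFun h0.2⟩
  · rintro ⟨h1, h2, h3⟩
    refine (preSystem_family C B D α β).system_of_asym ?_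
    rw [key h1, bandDart_eq_zero_iff hk]
    exact ⟨funext h2, funext h3⟩

/-- The difference of both sides solves the local relations and vanishes on all the selected paths.
-/
theorem PreSystem.eq_family (hk : 1 < k) {F : ZMod (4 * k + 4) → ZMod (4 * k + 4) →
    ZMod (4 * k + 4) → M} (hF : PreSystem (bandGraph k) F) :
    F = family (fun j => F j (j + 1) (j + 2)) (fun j => F j (j + 2) (j + 1))
      (fun j => F j (j + 1) (j + 3)) (fun i => F (cornerP k i) (cornerQ k i) (cornerR k i))
      (fun i => F (cornerQ k i) (cornerR k i) (cornerS k i)) := by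
  refine sub_eq_zero.1 (PreSystem.eq_zero_of_vanishesOnPaths
    ((preSystems M (bandGraph k)).sub_mem hF (preSystem_family _ _ _ _ _)) ?_ hk)
  refine ⟨fun j => ?_, fun j => ?_, fun j => ?_, fun i hi => ?_, fun i hi => ?_⟩ <;>
    simp only [Pi.sub_apply, sub_eq_zero]
  · rw [(family_band hk j).1]
  · rw [(family_band hk j).2.1]
  · rw [(family_band hk j).2.2]
  · rw [family_top hi]
  · rw [family_bottom hi]

end Asym

/-! ### Naturality in the coefficient group -/

section Naturality

open Classical

variable {k : ℕ} {M N : Type*} [AddCommGroup M] [AddCommGroup N] (φ : M →+ N)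

theorem map_pathFn {V : Type} (p q r : V) (m : M) (x y z : V) :
    φ (pathFn p q r m x y z) = pathFn p q r (φ m) x y z := by
  simp only [pathFn_apply, map_add, map_sub, apply_ite φ, map_zero]

theorem map_cycleFn {V : Type} (p q r s : V) (m : M) (x y z : V) :
    φ (cycleFn p q r s m x y z) = cycleFn p q r s (φ m) x y z := by
  simp only [cycleFn_apply, Pi.sub_apply, map_sub, map_pathFn]

theorem map_bandPath (b c : ZMod (4 * k + 4)) (f : ZMod (4 * k + 4) → M)
    (x y z : ZMod (4 * k + 4)) :
    φ (bandPath b c f x y z) = bandPath b c (fun j => φ (f j)) x y z := by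
  simp only [bandPath, Finset.sum_apply, map_sum, map_pathFn]

theorem map_family (C B D : ZMod (4 * k + 4) → M) (α β : ℕ → M) (x y z : ZMod (4 * k + 4)) :
    φ (family C B D α β x y z) = family (fun j => φ (C j)) (fun j => φ (B j)) (fun j => φ (D j))
      (fun i => φ (α i)) (fun i => φ (β i)) x y z := by
  simp only [family, stripPart, Pi.add_apply, Pi.sub_apply, Finset.sum_apply, map_add, map_sub,
    map_sum, map_bandPath, map_cycleFn]

theorem family_congr {C B D : ZMod (4 * k + 4) → M} {α β α' β' : ℕ → M}
    (hα : ∀ i < k, α i = α' i) (hβ : ∀ i < k, β i = β' i) :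
    family C B D α β = family C B D α' β' := by
  have : stripPart k α β = stripPart k α' β' := Finset.sum_congr rfl fun i hi => by
    rw [hα i (Finset.mem_range.1 hi), hβ i (Finset.mem_range.1 hi)]
  rw [family, family, this]

end Naturality

/-! ### Solution of the equations by torsion and free parameters -/

section Parameters

variable {k : ℕ} {M N : Type*} [AddCommGroup M] [AddCommGroup N]

/-- The wide equation gives `B`; after the substitution `C` and `D` enter only through three times a
difference of `C - D`. -/
theorem nearDefect_eq {C B D e : ZMod (4 * k + 4) → M}
    (h : ∀ j, wideDefect C B D j + e j = 0) (j : ZMod (4 * k + 4)) :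
    nearDefect C B D j = 3 • (C (j - 1) - D (j - 1)) - 3 • (C j - D j) +
      (e (j - 1) - 2 • e j) := by
  have hB : ∀ j, B j = D j - D (j - 1) - 2 • C j - e j := fun j => by
    have := h j
    rw [wideDefect] at this
    rw [← sub_eq_zero, ← this]
    abel
  have e2 : j - 1 - 1 = j - 2 := by ring
  rw [nearDefect, hB j, hB (j - 1), e2]
  abel

/-- Three times the slopes of the sequence `C - D` of a system. -/
theorem system_family_iff_slope (hk : 1 < k) {C B D : ZMod (4 * k + 4) → M} {α β : ℕ → M} {γ : M}
    (h0 : α 0 + β 0 = γ) :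
    System (bandGraph k) (family C B D α β) ↔ (∀ i < k, α i + β i = γ) ∧
      (∀ j, B j = D j - D (j - 1) - 2 • C j - (if j.val % 2 = 0 then γ else 0)) ∧
      (∀ j, 3 • (C j - D j) - 3 • (C (j - 1) - D (j - 1)) =
        if j.val % 2 = 0 then -(2 • γ) else γ) := by
  have hB : ∀ j, wideDefect C B D j + (if j.val % 2 = 0 then γ else 0) = 0 ↔
      B j = D j - D (j - 1) - 2 • C j - (if j.val % 2 = 0 then γ else 0) := fun j => by
    rw [wideDefect, ← sub_eq_zero (a := B j)]
    refine Eq.congr_left ?_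
    abel
  rw [system_family_iff hk, h0]
  simp only [← hB]
  refine and_congr_right fun _ => ?_
  rw [and_comm]
  refine and_congr_right fun h => forall_congr' fun j => ?_
  rw [nearDefect_eq h, ← sub_eq_zero (a := 3 • (C j - D j) - _), ← neg_eq_zero]
  refine Eq.congr_left ?_
  have hj := ZMod.val_lt j
  have hj' := ZMod.val_lt (j - 1)
  have := eq_add_one_iff.1 (sub_add_cancel j 1).symm
  -- Parities alternate also across `0`, as `4k + 4` is even, so exactly one of the correction terms
  -- at `j - 1` and `j` is `γ`.
  by_cases hp : j.val % 2 = 0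
  · rw [if_pos hp, if_pos hp, if_neg (by omega)]
    abel
  · rw [if_neg hp, if_neg hp, if_pos (by omega)]
    abel

variable (k M) in
/-- The parameters of a system on the band graph. -/
structure Parameters where
  /-- The level at `0`. -/
  base : M
  /-- The difference of the levels at `1` and `0`. -/
  slope : M
  /-- The deviations of the other levels from their values with constant slopes. -/
  dev : Fin (4 * k + 2) → M
  /-- The values on the wide paths. -/
  wide : ZMod (4 * k + 4) → M
  /-- The values on the squares. -/
  square : Fin k → M

/-- The coefficients of the slope in the levels. -/
def slopeCoeff (n : ℕ) : ℤ := if n % 2 = 0 then -((n / 2 : ℕ) : ℤ) else 1 - ((n / 2 : ℕ) : ℤ)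

namespace Parameters

/-- The torsion conditions on the parameters of a system. -/
structure Admissible (p : Parameters k M) : Prop where
  slope : (6 * k + 6) • p.slope = 0
  dev : ∀ i, 3 • p.dev i = 0

/-- The image of parameters under a homomorphism. -/
@[simps] def map (φ : M →+ N) (p : Parameters k M) : Parameters k N where
  base := φ p.base
  slope := φ p.slope
  dev i := φ (p.dev i)
  wide j := φ (p.wide j)
  square i := φ (p.square i)

variable (p : Parameters k M)

/-- The difference of the values on the paths `j, j + 1, j + 2` and `j, j + 1, j + 3`. -/
def level (n : ℕ) : M :=
  p.base + slopeCoeff n • p.slope +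
    -- The levels at 0 and 1 are `base` and `base + slope`, so deviations start at index 2.
    if h : 2 ≤ n ∧ n < 4 * k + 4 then p.dev ⟨n - 2, by omega⟩ else 0

/-- The values on the near paths. -/
def near (j : ZMod (4 * k + 4)) : M := p.level j.val + p.wide j

/-- The values on the far paths. -/
def far (j : ZMod (4 * k + 4)) : M :=
  -- Here `3 • p.slope` is the common sum of the two values of every square.
  p.wide j - p.wide (j - 1) - 2 • p.near j - (if j.val % 2 = 0 then 3 • p.slope else 0)

/-- The values on the upper paths in the squares. -/
def top (i : ℕ) : M := if h : i < k then p.square ⟨i, h⟩ else 0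

/-- The family with given parameters. -/
def toFamily : ZMod (4 * k + 4) → ZMod (4 * k + 4) → ZMod (4 * k + 4) → M :=
  family p.near p.far p.wide p.top fun i => 3 • p.slope - p.top i

theorem level_map (φ : M →+ N) (n : ℕ) : (p.map φ).level n = φ (p.level n) := by
  simp only [level, map_base, map_slope, map_dev, map_add, map_zsmul, apply_dite φ, map_zero]

theorem toFamily_map (φ : M →+ N) (x y z : ZMod (4 * k + 4)) :
    (p.map φ).toFamily x y z = φ (p.toFamily x y z) := by
  have h1 : ∀ j, (p.map φ).near j = φ (p.near j) := fun j => by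
    rw [near, near, level_map, map_add, map_wide]
  have h2 : ∀ j, (p.map φ).far j = φ (p.far j) := fun j => by
    simp only [far, h1, map_wide, map_slope, map_sub, map_nsmul, apply_ite φ, map_zero]
  have h3 : ∀ i, (p.map φ).top i = φ (p.top i) := fun i => by
    simp only [top, map_square, apply_dite φ, map_zero]
  rw [toFamily, toFamily, map_family, funext h1, funext h2, funext h3]
  simp only [map_slope, map_sub, map_nsmul]
  rfl

variable {p}

theorem three_nsmul_level (hp : p.Admissible) (n : ℕ) :
    3 • p.level n = 3 • p.base + slopeCoeff n • (3 • p.slope) := by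
  have : 3 • (if h : 2 ≤ n ∧ n < 4 * k + 4 then p.dev ⟨n - 2, by omega⟩ else 0) = 0 := by
    split_ifs
    · exact hp.dev _
    · exact smul_zero _
  rw [level, smul_add, this, smul_add, add_zero, smul_comm]

theorem system_toFamily (hk : 1 < k) (hp : p.Admissible) :
    System (bandGraph k) p.toFamily := by
  rw [toFamily, system_family_iff_slope hk (add_sub_cancel _ _)]
  refine ⟨fun i _ => add_sub_cancel _ _, fun j => rfl, fun j => ?_⟩
  have hj := ZMod.val_lt j
  have hj' := ZMod.val_lt (j - 1)
  have hv := eq_add_one_iff.1 (sub_add_cancel j 1).symm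
  rw [near, near, add_sub_cancel_right, add_sub_cancel_right, three_nsmul_level hp,
    three_nsmul_level hp, add_sub_add_left_eq_sub, ← sub_smul]
  by_cases h0 : j.val = 0
  · have h1 : slopeCoeff j.val - slopeCoeff (j - 1).val = 2 * k := by
      simp only [slopeCoeff]
      split_ifs <;> omega
    rw [h1, if_pos (by omega), ← sub_eq_zero, sub_neg_eq_add, ← hp.slope]
    module
  · have h1 : slopeCoeff j.val - slopeCoeff (j - 1).val = if j.val % 2 = 0 then -2 else 1 := by
      simp only [slopeCoeff]
      split_ifs <;> omega
    rw [h1]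
    split_ifs
    · module
    · module

/-- The levels are `Z = C - D`. Their increments are known only after multiplication by three, so `Z
n` is given by `Z 0` and the slope up to a 3-torsion deviation; closing the cycle bounds the order
of the slope. -/
theorem exists_eq_toFamily (hk : 1 < k) {F : ZMod (4 * k + 4) → ZMod (4 * k + 4) →
    ZMod (4 * k + 4) → M} (hF : System (bandGraph k) F) :
    ∃ p : Parameters k M, p.Admissible ∧ F = p.toFamily := by
  have hf := hF.toPreSystem.eq_family hk
  generalize (fun j => F j (j + 1) (j + 2)) = C at hf
  generalize (fun j => F j (j + 2) (j + 1)) = B at hf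
  generalize (fun j => F j (j + 1) (j + 3)) = D at hf
  generalize (fun i => F (cornerP k i) (cornerQ k i) (cornerR k i)) = α at hf
  generalize (fun i => F (cornerQ k i) (cornerR k i) (cornerS k i)) = β at hf
  subst hf
  obtain ⟨h1, h2, h3⟩ := (system_family_iff_slope hk rfl).1 hF
  set γ := α 0 + β 0 with hγ
  let Z : ℕ → M := fun n => C n - D n
  have hZ : ∀ n < 4 * k + 3, 3 • Z (n + 1) - 3 • Z n = if (n + 1) % 2 = 0 then -(2 • γ) else γ := by
    intro n hn
    have := h3 ((n + 1 : ℕ) : ZMod (4 * k + 4))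
    rw [val_natCast_of_lt (by omega)] at this
    simpa [Z] using this
  -- The element `γ` is three times the slope, which raises the order from `2k + 2` for `γ` to `6k +
  -- 6` for the slope.
  have hγ3 : γ = 3 • (Z 1 - Z 0) := by
    have := hZ 0 (by omega)
    rw [smul_sub]
    simpa using this.symm
  have hlev : ∀ n < 4 * k + 4, 3 • Z n = 3 • Z 0 + slopeCoeff n • γ := by
    intro n hn
    induction n with
    | zero => simp [slopeCoeff]
    | succ n ih =>
      have e : slopeCoeff (n + 1) = slopeCoeff n + if (n + 1) % 2 = 0 then -2 else 1 := by
        simp only [slopeCoeff]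
        split_ifs <;> omega
      rw [← sub_add_cancel (3 • Z (n + 1)) (3 • Z n), hZ n (by omega), ih (by omega), e]
      split_ifs
      · module
      · module
  refine ⟨⟨Z 0, Z 1 - Z 0, fun i => Z (i + 2) - Z 0 - slopeCoeff (i + 2) • (Z 1 - Z 0), D,
    fun i => α i⟩, ⟨?_, fun i => ?_⟩, ?_⟩
  -- The equation at `j = 0` compares `Z 0` with the last level `Z (4k + 3)` and closes the cycle.
  · have e := h3 0
    have e1 := hlev (4 * k + 3) (by omega)
    have e2 : (0 : ZMod (4 * k + 4)) - 1 = ((4 * k + 3 : ℕ) : ZMod (4 * k + 4)) := by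
      have : ((4 * k + 4 : ℕ) : ZMod (4 * k + 4)) = 0 := ZMod.natCast_self _
      push_cast at this ⊢
      linear_combination -this
    have e3 : slopeCoeff (4 * k + 3) = -(2 * k) := by
      simp only [slopeCoeff]
      split_ifs <;> omega
    have e4 : Z 0 = C 0 - D 0 := by simp [Z]
    rw [e2, ← e4] at e
    change 3 • Z 0 - 3 • Z (4 * k + 3) = _ at e
    rw [e1, e3, ZMod.val_zero, if_pos rfl, hγ3] at e
    change (6 * k + 6) • (Z 1 - Z 0) = 0
    rw [← sub_eq_zero] at e
    rw [← e]
    module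
  · have := hlev (i + 2) (by omega)
    change 3 • (Z (i + 2) - Z 0 - slopeCoeff (i + 2) • (Z 1 - Z 0)) = 0
    rw [smul_sub, smul_sub, this, hγ3]
    module
  · set p : Parameters k M := ⟨Z 0, Z 1 - Z 0,
      fun i => Z (i + 2) - Z 0 - slopeCoeff (i + 2) • (Z 1 - Z 0), D, fun i => α i⟩ with hp
    have hl : ∀ n < 4 * k + 4, p.level n = Z n := by
      intro n hn
      simp only [level, hp]
      rcases n with _ | _ | n
      · simp [slopeCoeff]
      · simp [slopeCoeff]
      · rw [dif_pos (by omega)]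
        simp
    have hnear : p.near = C := by
      funext j
      rw [near, hl _ (ZMod.val_lt j)]
      simp [Z, hp]
    have hfar : p.far = B := by
      funext j
      rw [far, hnear, h2 j, hγ3]
    have htop : ∀ i < k, α i = p.top i := fun i hi => by rw [top, dif_pos hi]
    rw [toFamily, hnear, hfar]
    refine family_congr htop fun i hi => ?_
    rw [← htop i hi, show 3 • p.slope = α i + β i from hγ3.symm.trans (h1 i hi).symm]
    abel

variable (p)

/-- All parameters can be recovered from values of the family: `wide` and `square` directly, the
others from the levels. -/
theorem map_eq_self (hk : 1 < k) (ψ : M →+ M)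
    (h : ∀ x y z, ψ (p.toFamily x y z) = p.toFamily x y z) :
    p.map ψ = p := by
  have hw : ∀ j, ψ (p.wide j) = p.wide j := fun j => by
    have := h j (j + 1) (j + 3)
    rwa [toFamily, (family_band hk j).2.2] at this
  have hn : ∀ j, ψ (p.near j) = p.near j := fun j => by
    have := h j (j + 1) (j + 2)
    rwa [toFamily, (family_band hk j).1] at this
  have hs : ∀ i, ψ (p.square i) = p.square i := fun i => by
    have := h (cornerP k i) (cornerQ k i) (cornerR k i)
    rwa [toFamily, family_top i.2, top, dif_pos i.2] at this
  have hl : ∀ n < 4 * k + 4, ψ (p.level n) = p.level n := fun n hn' => by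
    have := hn (n : ZMod (4 * k + 4))
    rwa [near, map_add, hw, add_left_inj, val_natCast_of_lt hn'] at this
  have hb : ψ p.base = p.base := by
    have := hl 0 (by omega)
    simpa [level, slopeCoeff] using this
  have hσ : ψ p.slope = p.slope := by
    have := hl 1 (by omega)
    simpa [level, slopeCoeff, hb] using this
  have hd : ∀ i, ψ (p.dev i) = p.dev i := fun i => by
    have := hl (i + 2) (by omega)
    rw [level, dif_pos (by omega), map_add, map_add, map_zsmul, hb, hσ, add_right_inj] at this
    exact this
  simp only [map, hb, hσ, hd, hw, hs]

end Parameters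

end Parameters

/-! ### The group that represents admissible parameters -/

section Universal

/-- The sum of `ℤ / n`, a finite power of `ℤ / m`, and a finite power of `ℤ`. -/
abbrev StdGroup (n m : ℕ) (ι κ : Type) : Type := ZMod n × (ι → ZMod m) × (κ → ℤ)

variable {n m : ℕ} {ι κ : Type} [Fintype ι] [Fintype κ] [DecidableEq ι] [DecidableEq κ]
  {M : Type*} [AddCommGroup M]

/-- A map from `ℤ / n` to the multiples of an element. -/
def zmodHom {σ : M} (hσ : n • σ = 0) : ZMod n →+ M :=
  ZMod.lift n ⟨zmultiplesHom M σ, by simpa using hσ⟩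

theorem zmodHom_one {σ : M} (hσ : n • σ = 0) : zmodHom hσ 1 = σ := by
  have := ZMod.lift_coe n ⟨zmultiplesHom M σ, by simpa using hσ⟩ 1
  simpa [zmodHom] using this

theorem exists_stdGroup_hom {σ : M} {θ : ι → M} (ζ : κ → M) (hσ : n • σ = 0)
    (hθ : ∀ i, m • θ i = 0) : ∃ φ : StdGroup n m ι κ →+ M, φ (1, 0, 0) = σ ∧
      (∀ i, φ (0, Pi.single i 1, 0) = θ i) ∧ ∀ i, φ (0, 0, Pi.single i 1) = ζ i := by
  refine ⟨(zmodHom hσ).coprod ((∑ i, (zmodHom (hθ i)).comp (Pi.evalAddMonoidHom _ i)).coprod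
    (∑ i, (zmultiplesHom M (ζ i)).comp (Pi.evalAddMonoidHom _ i))), ?_, fun i => ?_, fun i => ?_⟩
  · simp [zmodHom_one]
  · simp only [AddMonoidHom.coprod_apply, map_zero, zero_add, add_zero, AddMonoidHom.finsetSum_apply,
      AddMonoidHom.comp_apply, Pi.evalAddMonoidHom_apply]
    rw [Finset.sum_eq_single i, Pi.single_eq_same, zmodHom_one]
    · intro j _ hj
      rw [Pi.single_eq_of_ne hj, map_zero]
    · simp
  · simp only [AddMonoidHom.coprod_apply, map_zero, zero_add, AddMonoidHom.finsetSum_apply,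
      AddMonoidHom.comp_apply, Pi.evalAddMonoidHom_apply]
    rw [Finset.sum_eq_single i, Pi.single_eq_same]
    · simp
    · intro j _ hj
      rw [Pi.single_eq_of_ne hj, map_zero]
    · simp

theorem stdGroup_hom_ext {φ ψ : StdGroup n m ι κ →+ M} (hσ : φ (1, 0, 0) = ψ (1, 0, 0))
    (hθ : ∀ i, φ (0, Pi.single i 1, 0) = ψ (0, Pi.single i 1, 0))
    (hζ : ∀ i, φ (0, 0, Pi.single i 1) = ψ (0, 0, Pi.single i 1)) : φ = ψ := by
  have hz : ∀ (l : ℕ) {f g : ZMod l →+ M}, f 1 = g 1 → f = g := by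
    intro l f g h
    ext x
    obtain ⟨a, rfl⟩ := ZMod.intCast_surjective x
    rw [← zsmul_one a, map_zsmul, map_zsmul, h]
  have h1 : φ.comp (AddMonoidHom.inl _ _) = ψ.comp (AddMonoidHom.inl _ _) := hz n hσ
  have h2 : (φ.comp (AddMonoidHom.inr _ _)).comp (AddMonoidHom.inl _ _) =
      (ψ.comp (AddMonoidHom.inr _ _)).comp (AddMonoidHom.inl _ _) := by
    refine AddMonoidHom.functions_ext' _ _ _ fun i => hz m ?_
    exact hθ i
  have h3 : (φ.comp (AddMonoidHom.inr _ _)).comp (AddMonoidHom.inr _ _) =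
      (ψ.comp (AddMonoidHom.inr _ _)).comp (AddMonoidHom.inr _ _) := by
    refine AddMonoidHom.functions_ext' _ _ _ fun i => AddMonoidHom.ext_int ?_
    exact hζ i
  ext x
  obtain ⟨a, b, c⟩ := x
  have e : ((a, b, c) : StdGroup n m ι κ) = (a, 0) + ((0, (b, 0)) + (0, (0, c))) := by simp
  rw [e, map_add, map_add, map_add, map_add]
  exact congrArg₂ (· + ·) (DFunLike.congr_fun h1 a)
    (congrArg₂ (· + ·) (DFunLike.congr_fun h2 b) (DFunLike.congr_fun h3 c))

variable (k : ℕ)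

/-- The indices of the free parameters of a system. -/
abbrev FreeIndex : Type := Unit ⊕ ZMod (4 * k + 4) ⊕ Fin k

/-- The group that represents the systems on the band graph. -/
abbrev BandGroup : Type := StdGroup (6 * k + 6) 3 (Fin (4 * k + 2)) (FreeIndex k)

/-- The universal parameters. -/
def universalParameters : Parameters k (BandGroup k) where
  base := (0, 0, Pi.single (.inl ()) 1)
  slope := (1, 0, 0)
  dev i := (0, Pi.single i 1, 0)
  wide j := (0, 0, Pi.single (.inr (.inl j)) 1)
  square i := (0, 0, Pi.single (.inr (.inr i)) 1)

theorem universalParameters_admissible : (universalParameters k).Admissible where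
  slope := by
    refine Prod.ext ?_ (by simp [universalParameters])
    change (6 * k + 6) • (1 : ZMod (6 * k + 6)) = 0
    rw [nsmul_one, ZMod.natCast_self]
  dev i := by
    refine Prod.ext (by simp [universalParameters]) (Prod.ext ?_ (by simp [universalParameters]))
    change 3 • (Pi.single i 1 : Fin (4 * k + 2) → ZMod 3) = 0
    rw [← Pi.single_smul, show 3 • (1 : ZMod 3) = 0 from rfl, Pi.single_zero]

variable {k}

/-- Admissibility consists of precisely the relations that hold between the standard generators. -/
theorem exists_map_universalParameters {p : Parameters k M} (hp : p.Admissible) :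
    ∃ φ : BandGroup k →+ M, (universalParameters k).map φ = p := by
  obtain ⟨φ, h1, h2, h3⟩ := exists_stdGroup_hom (n := 6 * k + 6) (m := 3)
    (Sum.elim (fun _ => p.base) (Sum.elim p.wide p.square) : FreeIndex k → M) hp.slope hp.dev
  refine ⟨φ, ?_⟩
  have hb := h3 (.inl ())
  have hw := fun j => h3 (.inr (.inl j))
  have hs := fun i => h3 (.inr (.inr i))
  simp only [Sum.elim_inl, Sum.elim_inr] at hb hw hs
  simp only [Parameters.map, universalParameters, h1, h2, hb, hw, hs]

theorem eq_id_of_map_universalParameters {ψ : BandGroup k →+ BandGroup k}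
    (h : (universalParameters k).map ψ = universalParameters k) : ψ = AddMonoidHom.id _ := by
  refine stdGroup_hom_ext (congrArg Parameters.slope h)
    (fun i => congrFun (congrArg Parameters.dev h) i) fun i => ?_
  rcases i with i | i | i
  · exact congrArg Parameters.base h
  · exact congrFun (congrArg Parameters.wide h) i
  · exact congrFun (congrArg Parameters.square h) i

end Universal

/-! ### Identification of the strip graph with the band graph -/

section StripGraph

variable (k : ℕ)

/-- The position of a vertex of the strip graph in the cyclic order of the band. -/
def stripPos : ZMod (2 * k + 2) ⊕ ZMod (2 * k + 2) → ZMod (4 * k + 4)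
  | .inl i => ((2 * i.val : ℕ) : ZMod (4 * k + 4))
  | .inr i => ((2 * i.val + 1 : ℕ) : ZMod (4 * k + 4))

/-- The vertex of the strip graph at a position in the cyclic order of the band. -/
def stripVertex (x : ZMod (4 * k + 4)) : ZMod (2 * k + 2) ⊕ ZMod (2 * k + 2) :=
  if x.val % 2 = 0 then .inl ((x.val / 2 : ℕ) : ZMod (2 * k + 2))
  else .inr ((x.val / 2 : ℕ) : ZMod (2 * k + 2))

variable {k}

theorem val_stripPos_inl (i : ZMod (2 * k + 2)) : (stripPos k (.inl i)).val = 2 * i.val := by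
  have := ZMod.val_lt i
  exact val_natCast_of_lt (by omega)

theorem val_stripPos_inr (i : ZMod (2 * k + 2)) : (stripPos k (.inr i)).val = 2 * i.val + 1 := by
  have := ZMod.val_lt i
  exact val_natCast_of_lt (by omega)

variable (k) in
/-- The cyclic order of the vertices of the strip graph. -/
def stripEquiv : ZMod (2 * k + 2) ⊕ ZMod (2 * k + 2) ≃ ZMod (4 * k + 4) where
  toFun := stripPos k
  invFun := stripVertex k
  left_inv v := by
    rcases v with i | i
    · rw [stripVertex, val_stripPos_inl, if_pos (by omega), Nat.mul_div_cancel_left _ two_pos,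
        ZMod.natCast_zmod_val]
    · rw [stripVertex, val_stripPos_inr, if_neg (by omega),
        show (2 * i.val + 1) / 2 = i.val by omega, ZMod.natCast_zmod_val]
  right_inv x := by
    have hx := ZMod.val_lt x
    rw [stripVertex, val_eq_iff]
    split_ifs
    · rw [val_stripPos_inl, ZMod.val_natCast, Nat.mod_eq_of_lt (by omega)]
      omega
    · rw [val_stripPos_inr, ZMod.val_natCast, Nat.mod_eq_of_lt (by omega)]
      omega

theorem eq_add_one_iff_val {i j : ZMod (2 * k + 2)} :
    j = i + 1 ↔ j.val = i.val + 1 ∨ i.val + 1 = j.val + (2 * k + 2) := by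
  have hi := ZMod.val_lt i
  have hj := ZMod.val_lt j
  have h1 : (1 : ZMod (2 * k + 2)).val = 1 := by
    have := ZMod.val_natCast_of_lt (n := 2 * k + 2) (a := 1) (by omega)
    rwa [Nat.cast_one] at this
  rw [← (ZMod.val_injective _).eq_iff, ZMod.val_add, h1]
  by_cases h : i.val + 1 < 2 * k + 2
  · rw [Nat.mod_eq_of_lt h]; omega
  · rw [show i.val + 1 = 2 * k + 2 by omega, Nat.mod_self]; omega

theorem add_add_one_eq_zero_iff {i j : ZMod (2 * k + 2)} :
    i + j + 1 = 0 ↔ i.val + j.val + 1 = 2 * k + 2 := by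
  have hi := ZMod.val_lt i
  have hj := ZMod.val_lt j
  have : i + j + 1 = ((i.val + j.val + 1 : ℕ) : ZMod (2 * k + 2)) := by
    push_cast
    rw [ZMod.natCast_zmod_val, ZMod.natCast_zmod_val]
  rw [this, ZMod.natCast_eq_zero_iff]
  constructor
  · rintro ⟨c, hc⟩
    have : c = 1 := by
      have h1 : c < 2 := by
        by_contra h
        have : (2 * k + 2) * 2 ≤ (2 * k + 2) * c := Nat.mul_le_mul_left _ (by omega)
        omega
      rcases c with _ | _ | c
      · omega
      · rfl
      · omega
    rw [this] at hc
    omega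
  · intro h
    rw [h]

/-- The cycle edges and the edges between apexes become distance two, the sides of the triangles
distance one, and `i + j + 1 = 0` becomes the sum `4k + 2` of doubled positions. -/
theorem stripGraph_adj_iff (hk : 1 < k) (u v : ZMod (2 * k + 2) ⊕ ZMod (2 * k + 2)) :
    (bandGraph k).Adj (stripPos k u) (stripPos k v) ↔ (stripGraph k).Adj u v := by
  rw [stripGraph, SimpleGraph.fromRel_adj, bandGraph_adj]
  have hval : ∀ i j : ZMod (2 * k + 2), i = j ↔ i.val = j.val := fun i j =>
    (ZMod.val_injective _).eq_iff.symm
  rcases u with i | i <;> rcases v with j | j <;>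
    have hi := ZMod.val_lt i <;> have hj := ZMod.val_lt j <;>
    simp only [val_stripPos_inl, val_stripPos_inr, eq_add_one_iff_val, add_add_one_eq_zero_iff,
      ne_eq, Sum.inl.injEq, Sum.inr.injEq, BandAdj, reduceCtorEq] <;>
    simp only [hval, not_false_eq_true, true_and, or_false, false_or] <;>
    omega

/-- The strip graph is the band graph. -/
def stripIso (hk : 1 < k) : stripGraph k ≃g bandGraph k where
  toEquiv := stripEquiv k
  map_rel_iff' {u v} := stripGraph_adj_iff hk u v

end StripGraph

/-! ### Cohomology of the strip graph -/

section Main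

variable {k : ℕ}

theorem nonempty_cohomology_stripGraph_equiv (hk : 1 < k) (ν : (stripGraph k).edgeSet ↪ ℕ) :
    Nonempty (cohomology (stripGraph k) 3 ν 1 (8 * (k + 1) - 3) ≃+ BandGroup k) := by
  have hF := Parameters.system_toFamily hk (universalParameters_admissible k)
  refine nonempty_cohomology_equiv_of_system ν ?_ (stripIso hk) hF ?_ ?_
  · rw [Fintype.card_sum, ZMod.card]
    omega
  · intro M _ F' hF'
    obtain ⟨p, hp, rfl⟩ := Parameters.exists_eq_toFamily hk hF'
    obtain ⟨φ, rfl⟩ := exists_map_universalParameters hp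
    exact ⟨φ, fun x y z => (Parameters.toFamily_map _ φ x y z).symm⟩
  · intro ψ hψ
    exact eq_id_of_map_universalParameters (Parameters.map_eq_self _ hk ψ hψ)

theorem nonempty_cohomology_stripGraph_equiv_fin (hk : 1 < k)
    (ν : (stripGraph k).edgeSet ↪ ℕ) :
    Nonempty (cohomology (stripGraph k) 3 ν 1 (8 * (k + 1) - 3) ≃+
      ZMod (6 * k + 6) × (Fin (4 * k + 2) → ZMod 3) × (Fin (5 * k + 5) → ℤ)) := by
  obtain ⟨e⟩ := nonempty_cohomology_stripGraph_equiv hk ν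
  -- One base level, `4k + 4` wide values and `k` squares.
  have c : Fintype.card (FreeIndex k) = Fintype.card (Fin (5 * k + 5)) := by
    simp only [FreeIndex, Fintype.card_sum, ZMod.card, Fintype.card_fin, Fintype.card_unit]
    omega
  let r : (FreeIndex k → ℤ) ≃+ (Fin (5 * k + 5) → ℤ) :=
    (LinearEquiv.funCongrLeft ℤ ℤ (Fintype.equivOfCardEq c).symm).toAddEquiv
  exact ⟨e.trans ((AddEquiv.refl _).prodCongr ((AddEquiv.refl _).prodCongr r))⟩

end Main

end ChromaticCohomology

theorem corollary5p1 :
    (∀ (k : ℕ), 1 < k → ∀ ν : (ChromaticCohomology.stripGraph k).edgeSet ↪ ℕ,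
      Nonempty (ChromaticCohomology.cohomology (ChromaticCohomology.stripGraph k) 3 ν
          1 (8 * (k + 1) - 3) ≃+
        ZMod (6 * k + 6) × (Fin (4 * k + 2) → ZMod 3) × (Fin (5 * k + 5) → ℤ))) ∧
    (∀ N : ℕ, ∃ k : ℕ, 1 < k ∧ ∃ n : ℕ, N ≤ n ∧ 0 < n ∧ ∃ (B : Type) (_ : AddCommGroup B),
      ∀ ν : (ChromaticCohomology.stripGraph k).edgeSet ↪ ℕ,
        Nonempty (ChromaticCohomology.cohomology (ChromaticCohomology.stripGraph k) 3 ν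
          1 (8 * (k + 1) - 3) ≃+ ZMod n × B)) := by
  refine ⟨fun k hk ν => ChromaticCohomology.nonempty_cohomology_stripGraph_equiv_fin hk ν,
    fun N => ⟨N + 2, by omega, 6 * (N + 2) + 6, by omega, by omega,
      (Fin (4 * (N + 2) + 2) → ZMod 3) × (Fin (5 * (N + 2) + 5) → ℤ), inferInstance, fun ν =>
      ChromaticCohomology.nonempty_cohomology_stripGraph_equiv_fin (by omega) ν⟩⟩

end
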